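/- For $a,T>0$ let $K_{a,T}$ be the integral operator on $L^2(\mathbb{R})$, $(K_{a,T}f)(x)=\int_{-\infty}^{\infty}K(x,y)f(y)\,dy$, with kernel $$K(x,y)=\frac1\pi\cdot\frac1{T^2+(x-y)^2+a^2(x^2+y^2)^2}.$$ It maps the closed subspace $H^o\subset L^2(\mathbb{R})$ of odd functions into itself; let $E^o(a,T)$ denote the largest eigenvalue of its restriction $K^o_{a,T}=K_{a,T}|_{H^o}$. There are absolute constants $c,C,a_0>0$ such that for every $0<a<a_0$: the equation $E^o(a,T)=1$ has a solution $T=1-\tau(a)$ with $0<T<1$, and every solution $T=1-\tau(a)>0$ of this equation satisfies $$c\,a^{2/5}\le\tau(a)\le C\,a^{2/5}.$$ -/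

import Mathlib

open MeasureTheory

/-- The anisotropic kernel `(1/π) / (T² + (x - y)² + a² (x² + y²)²)`. -/
noncomputable def gapKernel (a T x y : ℝ) : ℝ :=
  (1 / Real.pi) * (1 / (T ^ 2 + (x - y) ^ 2 + a ^ 2 * (x ^ 2 + y ^ 2) ^ 2))

/-- The Hilbert space `L²(ℝ)` of complex-valued functions with Lebesgue measure. -/
abbrev L2Line : Type := Lp ℂ 2 (volume : Measure ℝ)

theorem gapKernel_nonneg (a T x y : ℝ) : 0 ≤ gapKernel a T x y := by
  unfold gapKernel; positivity

theorem continuous_gapKernel (a : ℝ) {T : ℝ} (hT : 0 < T) :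
    Continuous (fun p : ℝ × ℝ => gapKernel a T p.1 p.2) := by
  unfold gapKernel
  refine continuous_const.mul (continuous_const.div (by fun_prop) fun p => ?_)
  positivity

theorem gapKernel_le {a T : ℝ} (ha : 0 < a) (hT : 0 < T) :
    ∃ C : ℝ, 0 ≤ C ∧ ∀ x y : ℝ,
      gapKernel a T x y ≤ C * ((1 + x ^ 2)⁻¹ * (1 + y ^ 2)⁻¹) := by
  refine ⟨(1 / Real.pi) * (2 / T ^ 2 + 2 / a ^ 2), by positivity, fun x y => ?_⟩
  unfold gapKernel
  rw [mul_assoc, ← mul_inv]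
  refine mul_le_mul_of_nonneg_left ?_ (by positivity)
  rw [← div_eq_mul_inv, div_le_div_iff₀ (by positivity) (by positivity), one_mul]
  have h1 : (1 + x ^ 2) * (1 + y ^ 2) ≤ 2 + 2 * (x ^ 2 + y ^ 2) ^ 2 := by
    nlinarith [sq_nonneg (x ^ 2 + y ^ 2 - 1), sq_nonneg (x * y), sq_nonneg (x ^ 2),
      sq_nonneg (y ^ 2), sq_nonneg (x ^ 2 - y ^ 2)]
  refine h1.trans ?_
  have h2 : (2 / T ^ 2) * T ^ 2 = 2 := by field_simp
  have h3 : (2 / a ^ 2) * (a ^ 2 * (x ^ 2 + y ^ 2) ^ 2) = 2 * (x ^ 2 + y ^ 2) ^ 2 := by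
    field_simp
  have h4 : 0 ≤ (2 / T ^ 2) * ((x - y) ^ 2 + a ^ 2 * (x ^ 2 + y ^ 2) ^ 2) := by positivity
  have h5 : 0 ≤ (2 / a ^ 2) * (T ^ 2 + (x - y) ^ 2) := by positivity
  nlinarith

theorem memLp_inv_one_add_sq :
    MemLp (fun x : ℝ => (1 + x ^ 2)⁻¹) 2 (volume : Measure ℝ) := by
  have hc : Continuous (fun x : ℝ => (1 + x ^ 2)⁻¹) :=
    Continuous.inv₀ (by fun_prop) fun x => by positivity
  rw [memLp_two_iff_integrable_sq hc.aestronglyMeasurable]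
  refine integrable_inv_one_add_sq.mono' (hc.pow 2).aestronglyMeasurable
    (Filter.Eventually.of_forall fun x => ?_)
  have h0 : (0 : ℝ) ≤ (1 + x ^ 2)⁻¹ := by positivity
  have h1 : (1 + x ^ 2)⁻¹ ≤ (1 : ℝ) := inv_le_one_of_one_le₀ (by nlinarith [sq_nonneg x])
  rw [Real.norm_of_nonneg (by positivity)]
  nlinarith

theorem integrable_inv_one_add_sq_mul_norm (f : L2Line) :
    Integrable (fun y : ℝ => (1 + y ^ 2)⁻¹ * ‖f y‖) :=
  memLp_inv_one_add_sq.integrable_mul (Lp.memLp f).norm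

theorem norm_gapKernel_mul_le {a T C : ℝ}
    (hC : ∀ x y : ℝ, gapKernel a T x y ≤ C * ((1 + x ^ 2)⁻¹ * (1 + y ^ 2)⁻¹))
    (f : L2Line) (x y : ℝ) :
    ‖(gapKernel a T x y : ℂ) * f y‖ ≤ C * (1 + x ^ 2)⁻¹ * ((1 + y ^ 2)⁻¹ * ‖f y‖) := by
  rw [norm_mul, Complex.norm_real, Real.norm_of_nonneg (gapKernel_nonneg a T x y)]
  calc gapKernel a T x y * ‖f y‖
      ≤ C * ((1 + x ^ 2)⁻¹ * (1 + y ^ 2)⁻¹) * ‖f y‖ :=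
        mul_le_mul_of_nonneg_right (hC x y) (norm_nonneg _)
    _ = _ := by ring

theorem integrable_gapKernel_mul {a T : ℝ} (ha : 0 < a) (hT : 0 < T) (f : L2Line) (x : ℝ) :
    Integrable (fun y : ℝ => (gapKernel a T x y : ℂ) * f y) := by
  obtain ⟨C, -, hC⟩ := gapKernel_le ha hT
  refine ((integrable_inv_one_add_sq_mul_norm f).const_mul (C * (1 + x ^ 2)⁻¹)).mono' ?_
    (Filter.Eventually.of_forall (norm_gapKernel_mul_le hC f x))
  have hc : Continuous (fun y : ℝ => (gapKernel a T x y : ℂ)) :=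
    Complex.continuous_ofReal.comp
      ((continuous_gapKernel a hT).comp (Continuous.prodMk_right x))
  exact hc.aestronglyMeasurable.mul (Lp.memLp f).aestronglyMeasurable

theorem memLp_gapIntegral {a T : ℝ} (ha : 0 < a) (hT : 0 < T) (f : L2Line) :
    MemLp (fun x : ℝ => ∫ y : ℝ, (gapKernel a T x y : ℂ) * f y) 2 (volume : Measure ℝ) := by
  obtain ⟨C, -, hC⟩ := gapKernel_le ha hT
  have hm : StronglyMeasurable (fun x : ℝ => ∫ y : ℝ, (gapKernel a T x y : ℂ) * f y) := by
    refine StronglyMeasurable.integral_prod_right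
      (f := fun x y : ℝ => (gapKernel a T x y : ℂ) * f y) ?_
    exact (Complex.continuous_ofReal.comp (continuous_gapKernel a hT)).stronglyMeasurable.mul
      ((Lp.stronglyMeasurable f).comp_measurable measurable_snd)
  refine (memLp_inv_one_add_sq.const_mul
    (C * ∫ y : ℝ, (1 + y ^ 2)⁻¹ * ‖f y‖)).mono' hm.aestronglyMeasurable
    (Filter.Eventually.of_forall fun x => ?_)
  refine (norm_integral_le_of_norm_le
    ((integrable_inv_one_add_sq_mul_norm f).const_mul (C * (1 + x ^ 2)⁻¹))
    (Filter.Eventually.of_forall (norm_gapKernel_mul_le hC f x))).trans (le_of_eq ?_)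
  rw [integral_const_mul]
  ring

/-- The integral operator `(K f)(x) = ∫ K(x, y) f(y) dy` on `L²(ℝ)`, for `a, T > 0`. -/
noncomputable def gapOperator {a T : ℝ} (ha : 0 < a) (hT : 0 < T) : L2Line →ₗ[ℂ] L2Line where
  toFun f := (memLp_gapIntegral ha hT f).toLp
    (fun x : ℝ => ∫ y : ℝ, (gapKernel a T x y : ℂ) * f y)
  map_add' f g := by
    rw [← MemLp.toLp_add]
    refine MemLp.toLp_congr _ _ (Filter.Eventually.of_forall fun x => ?_)
    simp only [Pi.add_apply]
    rw [← integral_add (integrable_gapKernel_mul ha hT f x) (integrable_gapKernel_mul ha hT g x)]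
    refine integral_congr_ae ?_
    filter_upwards [Lp.coeFn_add f g] with y hy
    rw [hy, Pi.add_apply, mul_add]
  map_smul' c f := by
    rw [RingHom.id_apply, ← MemLp.toLp_const_smul]
    refine MemLp.toLp_congr _ _ (Filter.Eventually.of_forall fun x => ?_)
    simp only [Pi.smul_apply, smul_eq_mul]
    rw [← integral_const_mul]
    refine integral_congr_ae ?_
    filter_upwards [Lp.coeFn_smul c f] with y hy
    rw [hy, Pi.smul_apply, smul_eq_mul, mul_left_comm]

theorem ae_comp_neg {p : ℝ → Prop} (h : ∀ᵐ x : ℝ, p x) : ∀ᵐ x : ℝ, p (-x) :=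
  (Measure.measurePreserving_neg (volume : Measure ℝ)).quasiMeasurePreserving.ae h

/-- The subspace `Hᵒ` of odd functions in `L²(ℝ)`. -/
def oddSubspace : Submodule ℂ L2Line where
  carrier := {f | ∀ᵐ x : ℝ, f (-x) = -f x}
  zero_mem' := by
    filter_upwards [Lp.coeFn_zero ℂ 2 (volume : Measure ℝ),
      ae_comp_neg (Lp.coeFn_zero ℂ 2 (volume : Measure ℝ))] with x h1 h2
    rw [h1, h2]; simp
  add_mem' := by
    intro f g hf hg
    filter_upwards [hf, hg, Lp.coeFn_add f g, ae_comp_neg (Lp.coeFn_add f g)] with x h1 h2 h3 h4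
    rw [h3, h4, Pi.add_apply, Pi.add_apply, h1, h2, neg_add]
  smul_mem' := by
    intro c f hf
    filter_upwards [hf, Lp.coeFn_smul c f, ae_comp_neg (Lp.coeFn_smul c f)] with x h1 h3 h4
    rw [h3, h4, Pi.smul_apply, Pi.smul_apply, h1, smul_neg]

theorem gapOperator_mem_odd {a T : ℝ} (ha : 0 < a) (hT : 0 < T) :
    ∀ f ∈ oddSubspace, gapOperator ha hT f ∈ oddSubspace := by
  intro f hf
  have hK := (memLp_gapIntegral ha hT f).coeFn_toLp
  change ∀ᵐ x : ℝ, _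
  filter_upwards [hK, ae_comp_neg hK] with x h1 h2
  change ((memLp_gapIntegral ha hT f).toLp _ : ℝ → ℂ) (-x) =
    -((memLp_gapIntegral ha hT f).toLp _ : ℝ → ℂ) x
  rw [h1, h2, ← integral_neg_eq_self, ← integral_neg]
  refine integral_congr_ae ?_
  filter_upwards [hf] with y hy
  have hk : gapKernel a T (-x) (-y) = gapKernel a T x y := by
    unfold gapKernel
    rw [neg_sq, neg_sq, show (-x - -y) ^ 2 = (x - y) ^ 2 by ring]
  rw [hy, hk, mul_neg]

/-- The restriction `Kᵒ` of the integral operator to the odd functions. -/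
noncomputable def oddGapOperator {a T : ℝ} (ha : 0 < a) (hT : 0 < T) :
    oddSubspace →ₗ[ℂ] oddSubspace :=
  (gapOperator ha hT).restrict (gapOperator_mem_odd ha hT)

/-- `E` is the largest eigenvalue `Eᵒ(a, T)` of the operator `Kᵒ`. -/
def IsOddTopEigenvalue {a T : ℝ} (ha : 0 < a) (hT : 0 < T) (E : ℝ) : Prop :=
  IsGreatest {μ : ℝ | Module.End.HasEigenvalue (oddGapOperator ha hT) (μ : ℂ)} E

/-!
Write `ε = a^(2/5)`. For `a = 0` the operator `K` is `T⁻¹` times the Poisson semigroup at time `T`,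
so to first order `K - 1` is `(1 - T) - |D| - 2 a² x⁴`; on functions of width `L` the last two terms
have sizes `1/L` and `a² L⁴`, which balance at `L = 1/ε` with common value `ε`. Hence the top
eigenvalue passes `1` when `1 - T` is of order `ε`.

*Lower bound on `1 - T`* (`lt_of_hasEigenvalue_one_le`). The function `h(x) = 1 / (x² + L²)`, with
`L = 4/ε`, satisfies `K h ≤ q h` with a constant `q < 1` as long as `T ≥ 1 - ε/100`
(`lintegral_gapKernel_mul_bump_le`). The integrals are explicit by the semigroup law
`P_T * P_L = P_{T+L}` of the Poisson kernels (`integrable_and_integral_poisson`). An eigenfunction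
for an eigenvalue at least `1` satisfies `|f| ≤ K |f|`; integrating against `h` forces `f = 0`
(`eq_zero_of_supersolution`). Oddness plays no role here.

*Upper bound on `1 - T`* (`one_lt_oddGapSup`). The trial function is an odd Lipschitz bump supported
on `[-L, L]`, `L = 1/ε`. Only the odd part of the kernel acts on it, this part has the sign of `x y`
and decreases in the zeroth order term of the denominator, so on the support `K` may be replaced by
the Poisson kernel with `T² + 4 a² L⁴ = T² + 4ε` in place of `T²`
(`integral_oddBump_mul_poisson_le`). The loss against the full mass of that kernel is half the
integral of `(F(x) - F(y))²` against it, which is bounded independently of `L`, while `‖F‖²` is of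
order `L`. So the Rayleigh quotient exceeds `1` once `1 - T` is a large multiple of `ε`.

*Existence.* `Kᵒ` is symmetric and compact (`isCompactOperator_oddGapCLM`), so the supremum of its
Rayleigh quotient, if positive, is its largest eigenvalue (`isGreatest_rayleighSup`). This supremum
is continuous in `T` (`abs_oddGapSup_sub_le`), above `1` for small `T` and at most `1` at `T = 1`.
-/

/-! ### The top of the spectrum of a compact symmetric operator -/

open Module End ContinuousLinearMap in
/-- If `A` is compact and symmetric, `M ≠ 0` is not an eigenvalue and `⟪A x, x⟫ ≤ M ‖x‖²`, then
`M` is not the best constant. Indeed `B = M - A` is bounded below in norm by compactness, and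
`‖B x‖²` is controlled by `⟪B x, x⟫`, since `B` is nonnegative. -/
theorem exists_pos_reApplyInnerSelf_le {E : Type*} [NormedAddCommGroup E] [InnerProductSpace ℂ E]
    {A : E →L[ℂ] E} (hA : (A : E →ₗ[ℂ] E).IsSymmetric) (hc : IsCompactOperator A) {M : ℝ}
    (hM : M ≠ 0) (hle : ∀ x, A.reApplyInnerSelf x ≤ M * ‖x‖ ^ 2)
    (hev : ¬ HasEigenvalue (A : End ℂ E) (M : ℂ)) :
    ∃ c : ℝ, 0 < c ∧ ∀ x, A.reApplyInnerSelf x ≤ (M - c) * ‖x‖ ^ 2 := by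
  obtain ⟨k, hk0, hk⟩ := antilipschitzWith_iff_exists_mul_le_norm.mp
    (hc.antilipschitz_of_not_hasEigenvalue (by exact_mod_cast hM) hev)
  set B : E →L[ℂ] E := (M : ℂ) • 1 - A with hB
  have hk' : ∀ x, k * ‖x‖ ≤ ‖B x‖ := fun x => by
    simpa [hB, norm_sub_rev] using hk x
  have hsq : ∀ y : E, (inner ℂ y y).re = ‖y‖ ^ 2 := fun y => inner_self_eq_norm_sq (𝕜 := ℂ) y
  have hBx : ∀ x, (inner ℂ (B x) x).re = M * ‖x‖ ^ 2 - A.reApplyInnerSelf x := fun x => by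
    simp only [hB, sub_apply, smul_apply, inner_sub_left, inner_smul_left, reApplyInnerSelf_apply]
    simp [← hsq]
  have hBs : ∀ x y, inner ℂ (B x) y = inner ℂ x (B y) := fun x y => by
    have := hA x y
    simp only [coe_coe] at this
    simp only [hB, sub_apply, smul_apply, one_apply_eq_self, inner_sub_left, inner_sub_right,
      inner_smul_left, inner_smul_right, this, Complex.conj_ofReal]
  set N : ℝ := ‖B‖ + 1 with hN
  have hN0 : 0 < N := by positivity
  -- Expanding the form at `N x - B x` gives the Cauchy-Schwarz bound `‖B x‖² ≤ N ⟪B x, x⟫`.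
  have key : ∀ x, ‖B x‖ ^ 2 ≤ N * (inner ℂ (B x) x).re := fun x => by
    have h0 : 0 ≤ (inner ℂ (B ((N : ℂ) • x - B x)) ((N : ℂ) • x - B x)).re := by
      rw [hBx]; linarith [hle ((N : ℂ) • x - B x)]
    have h1 : (inner ℂ (B ((N : ℂ) • x - B x)) ((N : ℂ) • x - B x)).re =
        N ^ 2 * (inner ℂ (B x) x).re - 2 * N * ‖B x‖ ^ 2 + (inner ℂ (B (B x)) (B x)).re := by
      simp only [map_sub, map_smul, inner_sub_left, inner_sub_right, inner_smul_left,
        inner_smul_right, hBs (B x) x, Complex.conj_ofReal, Complex.sub_re, Complex.re_ofReal_mul,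
        hsq]
      ring
    have h2 : (inner ℂ (B (B x)) (B x)).re ≤ N * ‖B x‖ ^ 2 := by
      calc (inner ℂ (B (B x)) (B x)).re ≤ ‖B (B x)‖ * ‖B x‖ := re_inner_le_norm (𝕜 := ℂ) _ _
        _ ≤ (‖B‖ * ‖B x‖) * ‖B x‖ := by gcongr; exact B.le_opNorm _
        _ ≤ N * ‖B x‖ ^ 2 := by nlinarith [sq_nonneg ‖B x‖]
    have h3 : 0 ≤ N * (N * (inner ℂ (B x) x).re - ‖B x‖ ^ 2) := by nlinarith
    linarith [nonneg_of_mul_nonneg_right h3 hN0]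
  refine ⟨k ^ 2 / N, by positivity, fun x => ?_⟩
  have h1 : (k * ‖x‖) ^ 2 ≤ ‖B x‖ ^ 2 := by
    have := hk' x; gcongr
  have h2 := h1.trans (key x)
  rw [hBx] at h2
  have : k ^ 2 / N * ‖x‖ ^ 2 ≤ M * ‖x‖ ^ 2 - A.reApplyInnerSelf x := by
    rw [div_mul_eq_mul_div, div_le_iff₀ hN0]; linarith
  linarith

/-- The supremum of the Rayleigh quotient. It is nonnegative, the quotient at `0` being `0`. -/
noncomputable def rayleighSup {E : Type*} [NormedAddCommGroup E] [InnerProductSpace ℂ E]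
    (A : E →L[ℂ] E) : ℝ := ⨆ x, A.rayleighQuotient x

section RayleighSup

variable {E : Type*} [NormedAddCommGroup E] [InnerProductSpace ℂ E]

theorem bddAbove_range_rayleighQuotient (A : E →L[ℂ] E) :
    BddAbove (Set.range A.rayleighQuotient) :=
  ⟨‖A‖, by rintro _ ⟨x, rfl⟩; exact (le_abs_self _).trans (A.rayleighQuotient_le_norm x)⟩

theorem reApplyInnerSelf_le_rayleighSup (A : E →L[ℂ] E) (x : E) :
    A.reApplyInnerSelf x ≤ rayleighSup A * ‖x‖ ^ 2 := by
  rcases eq_or_ne x 0 with rfl | hx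
  · simp [ContinuousLinearMap.reApplyInnerSelf_apply]
  · have h := le_ciSup (bddAbove_range_rayleighQuotient A) x
    rwa [ContinuousLinearMap.rayleighQuotient, div_le_iff₀ (by positivity)] at h

theorem rayleighSup_le {A : E →L[ℂ] E} {M : ℝ} (hM : 0 ≤ M)
    (h : ∀ x, A.reApplyInnerSelf x ≤ M * ‖x‖ ^ 2) : rayleighSup A ≤ M := by
  refine ciSup_le fun x => ?_
  rcases eq_or_ne x 0 with rfl | hx
  · simpa using hM
  · rw [ContinuousLinearMap.rayleighQuotient, div_le_iff₀ (by positivity)]; exact h x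

theorem rayleighSup_nonneg (A : E →L[ℂ] E) : 0 ≤ rayleighSup A := by
  have h := le_ciSup (bddAbove_range_rayleighQuotient A) 0
  rwa [ContinuousLinearMap.rayleighQuotient_apply_zero] at h

/-- The supremum of the Rayleigh quotient of a compact symmetric operator, if positive, is the
largest real eigenvalue. -/
theorem isGreatest_rayleighSup {A : E →L[ℂ] E} (hA : (A : E →ₗ[ℂ] E).IsSymmetric)
    (hc : IsCompactOperator A) (h0 : 0 < rayleighSup A) :
    IsGreatest {μ : ℝ | Module.End.HasEigenvalue (A : Module.End ℂ E) (μ : ℂ)}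
      (rayleighSup A) := by
  constructor
  · by_contra hev
    obtain ⟨c, hc0, hle⟩ := exists_pos_reApplyInnerSelf_le hA hc h0.ne'
      (reApplyInnerSelf_le_rayleighSup A) hev
    have h1 : rayleighSup A ≤ max (rayleighSup A - c) 0 :=
      rayleighSup_le (le_max_right _ _) fun x => (hle x).trans (by gcongr; exact le_max_left _ _)
    rcases le_max_iff.mp h1 with h | h <;> linarith
  · intro μ hμ
    obtain ⟨v, hv⟩ := hμ.exists_hasEigenvector
    have h1 := reApplyInnerSelf_le_rayleighSup A v
    have hv1 : A v = (μ : ℂ) • v := hv.apply_eq_smul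
    have hv0 : 0 < ‖v‖ := norm_pos_iff.mpr hv.2
    have h2 : A.reApplyInnerSelf v = μ * ‖v‖ ^ 2 := by
      rw [ContinuousLinearMap.reApplyInnerSelf_apply, hv1, inner_smul_left, Complex.conj_ofReal,
        ← inner_self_eq_norm_sq (𝕜 := ℂ) v]
      exact Complex.re_ofReal_mul _ _
    rw [h2] at h1
    exact le_of_mul_le_mul_right h1 (by positivity)

theorem abs_rayleighSup_sub_le {A B : E →L[ℂ] E} {δ : ℝ}
    (h : ∀ x, |A.reApplyInnerSelf x - B.reApplyInnerSelf x| ≤ δ * ‖x‖ ^ 2) (hδ : 0 ≤ δ) :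
    |rayleighSup A - rayleighSup B| ≤ δ := by
  have h1 : rayleighSup A ≤ rayleighSup B + δ :=
    rayleighSup_le (add_nonneg (rayleighSup_nonneg B) hδ) fun x => by
      linarith [(abs_le.mp (h x)).2, reApplyInnerSelf_le_rayleighSup B x]
  have h2 : rayleighSup B ≤ rayleighSup A + δ :=
    rayleighSup_le (add_nonneg (rayleighSup_nonneg A) hδ) fun x => by
      linarith [(abs_le.mp (h x)).1, reApplyInnerSelf_le_rayleighSup A x]
  exact abs_le.mpr ⟨by linarith, by linarith⟩

end RayleighSup

/-! ### Symmetry, compactness and continuity of the operator -/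

/-- The weight `x ↦ (1 + x²)⁻¹`, as an element of `L²(ℝ)`. -/
noncomputable def decayWeight : Lp ℝ 2 (volume : Measure ℝ) := memLp_inv_one_add_sq.toLp _

theorem integral_inv_one_add_sq_mul_norm_le (f : L2Line) :
    ∫ y : ℝ, (1 + y ^ 2)⁻¹ * ‖f y‖ ≤ ‖decayWeight‖ * ‖f‖ := by
  have hf := (Lp.memLp f).norm
  have h1 : ‖hf.toLp _‖ = ‖f‖ := by rw [Lp.norm_toLp, eLpNorm_norm, Lp.norm_def]
  rw [← h1]
  refine le_trans (le_of_eq ?_) (real_inner_le_norm decayWeight (hf.toLp _))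
  rw [L2.inner_def]
  refine integral_congr_ae ?_
  filter_upwards [memLp_inv_one_add_sq.coeFn_toLp, hf.coeFn_toLp] with x hx hy
  rw [decayWeight, hx, hy, real_inner_eq_re_inner]
  simp [mul_comm]

theorem norm_le_mul_norm_decayWeight {g : L2Line} {c : ℝ}
    (h : ∀ᵐ x : ℝ, ‖g x‖ ≤ c * (1 + x ^ 2)⁻¹) : ‖g‖ ≤ c * ‖decayWeight‖ := by
  refine Lp.norm_le_mul_norm_of_ae_le_mul ?_
  filter_upwards [h, memLp_inv_one_add_sq.coeFn_toLp] with x hx hy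
  rw [decayWeight, hy, Real.norm_of_nonneg (by positivity)]
  exact hx

theorem coeFn_gapOperator {a T : ℝ} (ha : 0 < a) (hT : 0 < T) (f : L2Line) :
    gapOperator ha hT f =ᵐ[volume] fun x : ℝ => ∫ y : ℝ, (gapKernel a T x y : ℂ) * f y :=
  (memLp_gapIntegral ha hT f).coeFn_toLp

theorem norm_integral_mul_le_of_le {k : ℝ → ℂ} {c x : ℝ} (hc : 0 ≤ c)
    (hk : ∀ y, ‖k y‖ ≤ c * ((1 + x ^ 2)⁻¹ * (1 + y ^ 2)⁻¹)) (f : L2Line) :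
    ‖∫ y : ℝ, k y * f y‖ ≤ c * (‖decayWeight‖ * ‖f‖) * (1 + x ^ 2)⁻¹ := by
  refine (norm_integral_le_of_norm_le
    ((integrable_inv_one_add_sq_mul_norm f).const_mul (c * (1 + x ^ 2)⁻¹))
    (Filter.Eventually.of_forall fun y => ?_)).trans ?_
  · rw [norm_mul]
    calc ‖k y‖ * ‖f y‖ ≤ c * ((1 + x ^ 2)⁻¹ * (1 + y ^ 2)⁻¹) * ‖f y‖ := by gcongr; exact hk y
      _ = _ := by ring
  · rw [integral_const_mul]
    calc c * (1 + x ^ 2)⁻¹ * ∫ y : ℝ, (1 + y ^ 2)⁻¹ * ‖f y‖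
        ≤ c * (1 + x ^ 2)⁻¹ * (‖decayWeight‖ * ‖f‖) := by
          gcongr; exact integral_inv_one_add_sq_mul_norm_le f
      _ = _ := by ring

theorem norm_gapKernel_le {a T C : ℝ}
    (hC : ∀ x y : ℝ, gapKernel a T x y ≤ C * ((1 + x ^ 2)⁻¹ * (1 + y ^ 2)⁻¹)) (x y : ℝ) :
    ‖(gapKernel a T x y : ℂ)‖ ≤ C * ((1 + x ^ 2)⁻¹ * (1 + y ^ 2)⁻¹) := by
  rw [Complex.norm_real, Real.norm_of_nonneg (gapKernel_nonneg a T x y)]; exact hC x y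

theorem exists_norm_gapOperator_le {a T : ℝ} (ha : 0 < a) (hT : 0 < T) :
    ∃ C : ℝ, ∀ f, ‖gapOperator ha hT f‖ ≤ C * ‖f‖ := by
  obtain ⟨C, hC0, hC⟩ := gapKernel_le ha hT
  refine ⟨C * ‖decayWeight‖ * ‖decayWeight‖, fun f => ?_⟩
  refine (norm_le_mul_norm_decayWeight (c := C * (‖decayWeight‖ * ‖f‖)) ?_).trans
    (le_of_eq (by ring))
  filter_upwards [coeFn_gapOperator ha hT f] with x hx
  rw [hx]
  exact norm_integral_mul_le_of_le hC0 (fun y => norm_gapKernel_le hC x y) f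

theorem gapKernel_comm (a T x y : ℝ) : gapKernel a T x y = gapKernel a T y x := by
  unfold gapKernel; ring_nf

theorem isSymmetric_gapOperator {a T : ℝ} (ha : 0 < a) (hT : 0 < T) :
    (gapOperator ha hT).IsSymmetric := by
  intro f g
  obtain ⟨C, hC0, hC⟩ := gapKernel_le ha hT
  rw [L2.inner_def, L2.inner_def]
  have h1 : ∫ x, inner ℂ (gapOperator ha hT f x) (g x) =
      ∫ x, ∫ y, (gapKernel a T x y : ℂ) * (starRingEnd ℂ (f y) * g x) := by
    refine integral_congr_ae ?_
    filter_upwards [coeFn_gapOperator ha hT f] with x hx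
    rw [hx, RCLike.inner_apply, ← integral_conj, ← integral_const_mul]
    refine integral_congr_ae (Filter.Eventually.of_forall fun y => ?_)
    simp only [map_mul, Complex.conj_ofReal]
    ring
  have h2 : ∫ y, inner ℂ (f y) (gapOperator ha hT g y) =
      ∫ y, ∫ x, (gapKernel a T x y : ℂ) * (starRingEnd ℂ (f y) * g x) := by
    refine integral_congr_ae ?_
    filter_upwards [coeFn_gapOperator ha hT g] with y hy
    rw [hy, RCLike.inner_apply, ← integral_mul_const]
    refine integral_congr_ae (Filter.Eventually.of_forall fun x => ?_)
    simp only [gapKernel_comm a T y x]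
    ring
  rw [h1, h2]
  refine integral_integral_swap ?_
  have hb := ((integrable_inv_one_add_sq_mul_norm g).mul_prod
    (integrable_inv_one_add_sq_mul_norm f)).const_mul C
  refine hb.mono' ?_ (Filter.Eventually.of_forall fun p => ?_)
  · refine (Complex.continuous_ofReal.comp
      (continuous_gapKernel a hT)).aestronglyMeasurable.mul (AEStronglyMeasurable.mul ?_ ?_)
    · exact ((Complex.continuous_conj.comp_stronglyMeasurable
        (Lp.stronglyMeasurable f)).comp_measurable measurable_snd).aestronglyMeasurable
    · exact ((Lp.stronglyMeasurable g).comp_measurable measurable_fst).aestronglyMeasurable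
  · simp only [Function.uncurry, norm_mul, RCLike.norm_conj]
    calc ‖(gapKernel a T p.1 p.2 : ℂ)‖ * (‖f p.2‖ * ‖g p.1‖)
        ≤ (C * ((1 + p.1 ^ 2)⁻¹ * (1 + p.2 ^ 2)⁻¹)) * (‖f p.2‖ * ‖g p.1‖) := by
          gcongr; exact norm_gapKernel_le hC _ _
      _ = _ := by ring

theorem memLp_gapKernel {a T : ℝ} (ha : 0 < a) (hT : 0 < T) (x : ℝ) :
    MemLp (fun y : ℝ => (gapKernel a T x y : ℂ)) 2 (volume : Measure ℝ) := by
  obtain ⟨C, -, hC⟩ := gapKernel_le ha hT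
  refine (memLp_inv_one_add_sq.const_mul (C * (1 + x ^ 2)⁻¹)).mono'
    (Complex.continuous_ofReal.comp ((continuous_gapKernel a hT).comp
      (Continuous.prodMk_right x))).aestronglyMeasurable
    (Filter.Eventually.of_forall fun y => (norm_gapKernel_le hC x y).trans (le_of_eq (by ring)))

open Filter Topology in
/-- Sequential weak compactness of balls in a separable Hilbert space. -/
theorem exists_weak_subseq_limit {H : Type*} [NormedAddCommGroup H] [InnerProductSpace ℂ H]
    [CompleteSpace H] [TopologicalSpace.SeparableSpace H] {r : ℝ} {f : ℕ → H}
    (hf : ∀ n, ‖f n‖ ≤ r) :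
    ∃ g : H, ‖g‖ ≤ r ∧ ∃ φ : ℕ → ℕ, StrictMono φ ∧
      ∀ h : H, Tendsto (fun n => inner ℂ h (f (φ n))) atTop (𝓝 (inner ℂ h g)) := by
  obtain ⟨ψ, hψ, φ, hφ, hlim⟩ := WeakDual.isSeqCompact_closedBall ℂ H 0 r
    (x := fun n => StrongDual.toWeakDual (InnerProductSpace.toDual ℂ H (f n)))
    (fun n => by simpa using hf n)
  refine ⟨(InnerProductSpace.toDual ℂ H).symm (WeakDual.toStrongDual ψ), ?_, φ, hφ, fun h => ?_⟩
  · simpa using hψ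
  · have h1 : Tendsto (fun n => inner ℂ (f (φ n)) h) atTop
        (𝓝 (inner ℂ ((InnerProductSpace.toDual ℂ H).symm (WeakDual.toStrongDual ψ)) h)) := by
      rw [InnerProductSpace.toDual_symm_apply]
      exact ((WeakDual.eval_continuous h).tendsto ψ).comp hlim
    have h2 := (Complex.continuous_conj.tendsto _).comp h1
    simpa only [Function.comp_def, inner_conj_symm] using h2

open Filter Topology in
/-- `K` maps weakly convergent bounded sequences to norm convergent ones: the images converge
pointwise and are dominated by a multiple of `(1 + x²)⁻¹`. -/
theorem tendsto_gapOperator_of_weak {a T : ℝ} (ha : 0 < a) (hT : 0 < T) {r : ℝ} {f : ℕ → L2Line}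
    {g : L2Line} (hf : ∀ n, ‖f n‖ ≤ r) (hg : ‖g‖ ≤ r)
    (h : ∀ k : L2Line, Tendsto (fun n => inner ℂ k (f n)) atTop (𝓝 (inner ℂ k g))) :
    Tendsto (fun n => gapOperator ha hT (f n)) atTop (𝓝 (gapOperator ha hT g)) := by
  obtain ⟨C, hC0, hC⟩ := gapKernel_le ha hT
  have hr : 0 ≤ r := (norm_nonneg g).trans hg
  have hK : ∀ u : L2Line, ∀ x : ℝ, inner ℂ ((memLp_gapKernel ha hT x).toLp _) u =
      ∫ y : ℝ, (gapKernel a T x y : ℂ) * u y := fun u x => by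
    rw [L2.inner_def]
    refine integral_congr_ae ?_
    filter_upwards [(memLp_gapKernel ha hT x).coeFn_toLp] with y hy
    rw [hy, RCLike.inner_apply, Complex.conj_ofReal, mul_comm]
  have hbd : ∀ u : L2Line, ‖u‖ ≤ r → ∀ x : ℝ, ‖∫ y : ℝ, (gapKernel a T x y : ℂ) * u y‖ ≤
      C * (‖decayWeight‖ * r) * (1 + x ^ 2)⁻¹ := fun u hu x =>
    (norm_integral_mul_le_of_le hC0 (fun y => norm_gapKernel_le hC x y) u).trans (by gcongr)
  rw [tendsto_iff_norm_sub_tendsto_zero]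
  have hsq : ∀ n, ‖gapOperator ha hT (f n) - gapOperator ha hT g‖ ^ 2 =
      ∫ x : ℝ, ‖(∫ y : ℝ, (gapKernel a T x y : ℂ) * f n y) -
        ∫ y : ℝ, (gapKernel a T x y : ℂ) * g y‖ ^ 2 := fun n => by
    rw [← inner_self_eq_norm_sq (𝕜 := ℂ), L2.inner_def, ← integral_re (L2.integrable_inner _ _)]
    refine integral_congr_ae ?_
    filter_upwards [coeFn_gapOperator ha hT (f n), coeFn_gapOperator ha hT g,
      Lp.coeFn_sub (gapOperator ha hT (f n)) (gapOperator ha hT g)] with x h1 h2 h3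
    rw [inner_self_eq_norm_sq, h3, Pi.sub_apply, h1, h2]
  have hlim : Tendsto (fun n => ‖gapOperator ha hT (f n) - gapOperator ha hT g‖ ^ 2) atTop
      (𝓝 0) := by
    simp_rw [hsq]
    have h0 : (0 : ℝ) = ∫ _ : ℝ, (0 : ℝ) := by simp
    rw [h0]
    refine tendsto_integral_of_dominated_convergence
      (fun x => (2 * (C * (‖decayWeight‖ * r))) ^ 2 * ((1 + x ^ 2)⁻¹) ^ 2) (fun n => ?_)
      (memLp_inv_one_add_sq.integrable_sq.const_mul _) (fun n => ?_) ?_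
    · exact ((((memLp_gapIntegral ha hT (f n)).1.sub (memLp_gapIntegral ha hT g).1).norm).pow 2)
    · refine Eventually.of_forall fun x => ?_
      rw [Real.norm_of_nonneg (by positivity), ← mul_pow]
      gcongr
      refine (norm_sub_le _ _).trans ?_
      linarith [hbd _ (hf n) x, hbd g hg x]
    · refine Eventually.of_forall fun x => ?_
      have h1 := h ((memLp_gapKernel ha hT x).toLp _)
      simp_rw [hK] at h1
      have h2 := (tendsto_iff_norm_sub_tendsto_zero.mp h1).pow 2
      simpa using h2
  have := hlim.sqrt
  simpa [Real.sqrt_sq] using this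

theorem isCompactOperator_gapOperator {a T : ℝ} (ha : 0 < a) (hT : 0 < T) :
    IsCompactOperator (gapOperator ha hT) := by
  have : Fact ((2 : ENNReal) ≠ ⊤) := ⟨by norm_num⟩
  rw [isCompactOperator_iff_exists_mem_nhds_image_subset_compact]
  refine ⟨Metric.closedBall 0 1, Metric.closedBall_mem_nhds _ one_pos,
    gapOperator ha hT '' Metric.closedBall 0 1, IsSeqCompact.isCompact ?_, subset_rfl⟩
  intro u hu
  choose f hf hfu using hu
  have hf' : ∀ n, ‖f n‖ ≤ 1 := fun n => by simpa using hf n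
  obtain ⟨g, hg, φ, hφ, hlim⟩ := exists_weak_subseq_limit hf'
  refine ⟨_, ⟨g, by simpa using hg, rfl⟩, φ, hφ, ?_⟩
  have := tendsto_gapOperator_of_weak ha hT (fun n => hf' (φ n)) hg hlim
  simpa only [Function.comp_def, ← hfu] using this

theorem isClosed_oddSubspace : IsClosed (oddSubspace : Set L2Line) := by
  have hmp := Measure.measurePreserving_neg (volume : Measure ℝ)
  have hiff : (oddSubspace : Set L2Line) =
      {f | Lp.compMeasurePreserving (Neg.neg : ℝ → ℝ) hmp f = -f} := by
    ext f
    change (∀ᵐ x : ℝ, f (-x) = -f x) ↔ Lp.compMeasurePreserving (Neg.neg : ℝ → ℝ) hmp f = -f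
    have h1 := Lp.coeFn_compMeasurePreserving f hmp
    have h2 := Lp.coeFn_neg f
    constructor
    · intro h
      refine Lp.ext ?_
      filter_upwards [h, h1, h2] with x hx h1 h2
      rw [h1, h2, Pi.neg_apply, Function.comp_apply, hx]
    · intro h
      rw [h] at h1
      filter_upwards [h1, h2] with x h1 h2
      rw [h2, Pi.neg_apply, Function.comp_apply] at h1
      exact h1.symm
  rw [hiff]
  exact isClosed_eq (Lp.isometry_compMeasurePreserving hmp).continuous continuous_neg

/-- The restriction `Kᵒ` as a continuous linear map. -/
noncomputable def oddGapCLM {a T : ℝ} (ha : 0 < a) (hT : 0 < T) : oddSubspace →L[ℂ] oddSubspace :=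
  (oddGapOperator ha hT).mkContinuousOfExistsBound
    ((exists_norm_gapOperator_le ha hT).imp fun _ h f => h f)

theorem coe_oddGapCLM {a T : ℝ} (ha : 0 < a) (hT : 0 < T) :
    (oddGapCLM ha hT : oddSubspace →ₗ[ℂ] oddSubspace) = oddGapOperator ha hT := rfl

theorem isSymmetric_oddGapCLM {a T : ℝ} (ha : 0 < a) (hT : 0 < T) :
    (oddGapCLM ha hT : oddSubspace →ₗ[ℂ] oddSubspace).IsSymmetric :=
  fun f g => isSymmetric_gapOperator ha hT f g

theorem isCompactOperator_oddGapCLM {a T : ℝ} (ha : 0 < a) (hT : 0 < T) :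
    IsCompactOperator (oddGapCLM ha hT) :=
  (isCompactOperator_gapOperator ha hT).restrict (gapOperator_mem_odd ha hT) isClosed_oddSubspace

/-- The supremum of the Rayleigh quotient of `Kᵒ`; if positive, this is `Eᵒ(a, T)`. -/
noncomputable def oddGapSup {a T : ℝ} (ha : 0 < a) (hT : 0 < T) : ℝ :=
  rayleighSup (oddGapCLM ha hT)

theorem isOddTopEigenvalue_oddGapSup {a T : ℝ} (ha : 0 < a) (hT : 0 < T)
    (h : 0 < oddGapSup ha hT) : IsOddTopEigenvalue ha hT (oddGapSup ha hT) :=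
by
  have h1 := isGreatest_rayleighSup (isSymmetric_oddGapCLM ha hT)
    (isCompactOperator_oddGapCLM ha hT) h
  rw [coe_oddGapCLM] at h1
  exact h1

theorem abs_gapKernel_sub_le {a T₀ T T' C : ℝ} (hT₀ : 0 < T₀) (hT : T₀ ≤ T)
    (hT' : T₀ ≤ T')
    (hC : ∀ x y : ℝ, gapKernel a T₀ x y ≤ C * ((1 + x ^ 2)⁻¹ * (1 + y ^ 2)⁻¹)) (x y : ℝ) :
    |gapKernel a T x y - gapKernel a T' x y| ≤
      |T ^ 2 - T' ^ 2| / T₀ ^ 2 * C * ((1 + x ^ 2)⁻¹ * (1 + y ^ 2)⁻¹) := by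
  refine le_trans ?_ ((mul_le_mul_of_nonneg_left (hC x y)
    (by positivity : 0 ≤ |T ^ 2 - T' ^ 2| / T₀ ^ 2)).trans (le_of_eq (by ring)))
  unfold gapKernel
  set V := (x - y) ^ 2 + a ^ 2 * (x ^ 2 + y ^ 2) ^ 2 with hV
  have hV0 : 0 ≤ V := by positivity
  simp only [add_assoc, ← hV]
  have h0 : 0 < T := hT₀.trans_le hT
  have h0' : 0 < T' := hT₀.trans_le hT'
  have e : (1 / Real.pi) * (1 / (T ^ 2 + V)) - (1 / Real.pi) * (1 / (T' ^ 2 + V)) =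
      (T' ^ 2 - T ^ 2) * ((1 / Real.pi) * (1 / (T ^ 2 + V)) * (1 / (T' ^ 2 + V))) := by
    field_simp
    ring
  have h1 : T₀ ^ 2 + V ≤ T ^ 2 + V := by gcongr
  have h2 : T₀ ^ 2 ≤ T' ^ 2 + V := by
    have : T₀ ^ 2 ≤ T' ^ 2 := by gcongr
    linarith
  rw [e, abs_mul, abs_sub_comm]
  calc |T ^ 2 - T' ^ 2| * |(1 / Real.pi) * (1 / (T ^ 2 + V)) * (1 / (T' ^ 2 + V))|
      = |T ^ 2 - T' ^ 2| * ((1 / Real.pi) * (1 / (T ^ 2 + V)) * (1 / (T' ^ 2 + V))) := by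
        rw [abs_of_nonneg (by positivity : 0 ≤ (1 / Real.pi) * (1 / (T ^ 2 + V)) *
          (1 / (T' ^ 2 + V)))]
    _ ≤ |T ^ 2 - T' ^ 2| * ((1 / Real.pi) * (1 / (T₀ ^ 2 + V)) * (1 / T₀ ^ 2)) := by gcongr
    _ = _ := by ring

theorem abs_oddGapSup_sub_le {a T₀ : ℝ} (ha : 0 < a) (hT₀ : 0 < T₀) :
    ∃ C : ℝ, 0 ≤ C ∧ ∀ {T T' : ℝ} (hT : 0 < T) (hT' : 0 < T'), T₀ ≤ T → T₀ ≤ T' →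
      |oddGapSup ha hT - oddGapSup ha hT'| ≤ C * |T ^ 2 - T' ^ 2| := by
  obtain ⟨C, hC0, hC⟩ := gapKernel_le ha hT₀
  refine ⟨C / T₀ ^ 2 * ‖decayWeight‖ ^ 2, by positivity, fun {T T'} hT hT' h h' => ?_⟩
  refine abs_rayleighSup_sub_le (fun f => ?_) (by positivity)
  have hn : ‖gapOperator ha hT f - gapOperator ha hT' f‖ ≤
      |T ^ 2 - T' ^ 2| / T₀ ^ 2 * C * (‖decayWeight‖ * ‖(f : L2Line)‖) * ‖decayWeight‖ := by
    refine norm_le_mul_norm_decayWeight ?_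
    filter_upwards [coeFn_gapOperator ha hT f, coeFn_gapOperator ha hT' f,
      Lp.coeFn_sub (gapOperator ha hT f) (gapOperator ha hT' f)] with x h1 h2 h3
    rw [h3, Pi.sub_apply, h1, h2, ← integral_sub (integrable_gapKernel_mul ha hT f x)
      (integrable_gapKernel_mul ha hT' f x)]
    simp only [← sub_mul]
    refine norm_integral_mul_le_of_le (by positivity) (fun y => ?_) _
    rw [← Complex.ofReal_sub, Complex.norm_real]
    exact abs_gapKernel_sub_le hT₀ h h' hC x y
  have hd : (oddGapCLM ha hT).reApplyInnerSelf f - (oddGapCLM ha hT').reApplyInnerSelf f =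
      (inner ℂ (gapOperator ha hT f - gapOperator ha hT' f) (f : L2Line)).re := by
    rw [inner_sub_left]; rfl
  rw [hd]
  refine (Complex.abs_re_le_norm _).trans ((norm_inner_le_norm _ _).trans ?_)
  refine (mul_le_mul_of_nonneg_right hn (norm_nonneg _)).trans (le_of_eq ?_)
  change _ = _ * ‖(f : L2Line)‖ ^ 2
  ring

/-! ### A supersolution and the lower bound on `1 - T` -/

open Filter Topology in
/-- The Poisson semigroup law `P_T * P_L = P_{T+L}`, for `P_T(x) = (T/π) / (T² + x²)`, up to
normalization. -/
theorem integrable_and_integral_poisson {T L : ℝ} (hT : 0 < T) (hTL : T < L) (x : ℝ) :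
    Integrable (fun y : ℝ => 1 / (T ^ 2 + (x - y) ^ 2) * (1 / (y ^ 2 + L ^ 2))) ∧
    ∫ y : ℝ, 1 / (T ^ 2 + (x - y) ^ 2) * (1 / (y ^ 2 + L ^ 2)) =
      Real.pi * (L + T) / (T * L * (x ^ 2 + (L + T) ^ 2)) := by
  have hL : 0 < L := hT.trans hTL
  have hLT : 0 < L - T := by linarith
  have hq : 0 < x ^ 2 + (L + T) ^ 2 := by positivity
  have hp : 0 < x ^ 2 + (L - T) ^ 2 := by positivity
  -- Partial fractions: `D` is the resultant of the two quadratic denominators.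
  set D := (x ^ 2 + (L + T) ^ 2) * (x ^ 2 + (L - T) ^ 2) with hD
  have hD0 : 0 < D := mul_pos hq hp
  set F : ℝ → ℝ := fun y => x / D * Real.log ((y ^ 2 + L ^ 2) / (T ^ 2 + (x - y) ^ 2)) +
    (x ^ 2 + L ^ 2 - T ^ 2) / D / T * Real.arctan ((y - x) / T) +
    (x ^ 2 + T ^ 2 - L ^ 2) / D / L * Real.arctan (y / L) with hF
  have hderiv : ∀ y, HasDerivAt F (1 / (T ^ 2 + (x - y) ^ 2) * (1 / (y ^ 2 + L ^ 2))) y := by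
    intro y
    have h1 : 0 < T ^ 2 + (x - y) ^ 2 := by positivity
    have h2 : 0 < y ^ 2 + L ^ 2 := by positivity
    have d2 : HasDerivAt (fun y : ℝ => y ^ 2 + L ^ 2) (2 * y) y := by
      simpa using (hasDerivAt_pow 2 y).add_const (L ^ 2)
    have d1 : HasDerivAt (fun y : ℝ => T ^ 2 + (x - y) ^ 2) (-(2 * (x - y))) y := by
      have := (((hasDerivAt_id y).const_sub x).pow 2).const_add (T ^ 2)
      simpa using this
    have dl := ((d2.div d1 h1.ne').log (div_pos h2 h1).ne').const_mul (x / D)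
    have da := (((hasDerivAt_id y).sub_const x).div_const T).arctan.const_mul
      ((x ^ 2 + L ^ 2 - T ^ 2) / D / T)
    have db := ((hasDerivAt_id y).div_const L).arctan.const_mul ((x ^ 2 + T ^ 2 - L ^ 2) / D / L)
    refine ((dl.add da).add db).congr_deriv ?_
    have h3 : (1 + ((y - x) / T) ^ 2) = (T ^ 2 + (x - y) ^ 2) / T ^ 2 := by field_simp; ring
    have h4 : (1 + (y / L) ^ 2) = (y ^ 2 + L ^ 2) / L ^ 2 := by field_simp; ring
    simp only [id, Pi.div_apply]
    rw [h3, h4]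
    field_simp
    rw [hD]
    ring
  have hlog : ∀ l : Filter ℝ, Tendsto (fun y : ℝ => y⁻¹) l (𝓝 0) → (∀ᶠ y in l, y ≠ 0) →
      Tendsto (fun y : ℝ => Real.log ((y ^ 2 + L ^ 2) / (T ^ 2 + (x - y) ^ 2))) l (𝓝 0) := by
    intro l hl hne
    have hc : ContinuousAt (fun z : ℝ =>
        Real.log ((1 + L ^ 2 * z ^ 2) / (T ^ 2 * z ^ 2 + (x * z - 1) ^ 2))) 0 := by
      refine ContinuousAt.log (ContinuousAt.div (by fun_prop) (by fun_prop) ?_) ?_ <;> norm_num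
    have h := hc.tendsto.comp hl
    simp only [Function.comp_def] at h
    norm_num at h
    refine h.congr' ?_
    filter_upwards [hne] with y hy
    congr 1
    have h1 : 0 < T ^ 2 + (x - y) ^ 2 := by positivity
    have e : T ^ 2 * (y ^ 2)⁻¹ + (x * y⁻¹ - 1) ^ 2 = (T ^ 2 + (x - y) ^ 2) / y ^ 2 := by
      field_simp
    rw [e]
    field_simp
  have htop : Tendsto F atTop (𝓝 (x / D * 0 + (x ^ 2 + L ^ 2 - T ^ 2) / D / T * (Real.pi / 2) +
      (x ^ 2 + T ^ 2 - L ^ 2) / D / L * (Real.pi / 2))) := by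
    have ha := tendsto_nhds_of_tendsto_nhdsWithin Real.tendsto_arctan_atTop
    refine (((hlog _ tendsto_inv_atTop_zero (eventually_ne_atTop 0)).const_mul _).add
      ((ha.comp ?_).const_mul _)).add ((ha.comp ?_).const_mul _)
    · exact (tendsto_id.atTop_add tendsto_const_nhds (C := -x)).atTop_div_const hT
    · exact tendsto_id.atTop_div_const hL
  have hbot : Tendsto F atBot (𝓝 (x / D * 0 + (x ^ 2 + L ^ 2 - T ^ 2) / D / T * (-(Real.pi / 2)) +
      (x ^ 2 + T ^ 2 - L ^ 2) / D / L * (-(Real.pi / 2)))) := by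
    have ha := tendsto_nhds_of_tendsto_nhdsWithin Real.tendsto_arctan_atBot
    refine (((hlog _ tendsto_inv_atBot_zero (eventually_ne_atBot 0)).const_mul _).add
      ((ha.comp ?_).const_mul _)).add ((ha.comp ?_).const_mul _)
    · exact (tendsto_id.atBot_add tendsto_const_nhds (C := -x)).atBot_div_const hT
    · exact tendsto_id.atBot_div_const hL
  have hint : Integrable (fun y : ℝ => 1 / (T ^ 2 + (x - y) ^ 2) * (1 / (y ^ 2 + L ^ 2))) := by
    have hb : Integrable (fun y : ℝ => 1 / T ^ 2 * (1 / L ^ 2) * (1 + (y / L) ^ 2)⁻¹) :=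
      (integrable_inv_one_add_sq.comp_div hL.ne').const_mul _
    refine hb.mono' (Continuous.aestronglyMeasurable ?_) (Eventually.of_forall fun y => ?_)
    · refine (continuous_const.div (by fun_prop) fun y => ?_).mul
        (continuous_const.div (by fun_prop) fun y => ?_) <;> positivity
    · rw [Real.norm_of_nonneg (by positivity)]
      have e : 1 / T ^ 2 * (1 / L ^ 2) * (1 + (y / L) ^ 2)⁻¹ =
          1 / T ^ 2 * (1 / (y ^ 2 + L ^ 2)) := by
        field_simp
        ring
      rw [e]
      gcongr
      nlinarith [sq_nonneg (x - y)]
  refine ⟨hint, ?_⟩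
  rw [integral_of_hasDerivAt_of_tendsto hderiv hint hbot htop]
  rw [hD]
  field_simp
  ring

theorem lintegral_poisson {T L : ℝ} (hT : 0 < T) (hTL : T < L) (x : ℝ) :
    ∫⁻ y : ℝ, ENNReal.ofReal (1 / Real.pi * (1 / (T ^ 2 + (x - y) ^ 2)) * (1 / (y ^ 2 + L ^ 2))) =
      ENNReal.ofReal ((L + T) / (T * L * (x ^ 2 + (L + T) ^ 2))) := by
  obtain ⟨h1, h2⟩ := integrable_and_integral_poisson hT hTL x
  simp only [mul_assoc]
  rw [← ofReal_integral_eq_lintegral_ofReal (h1.const_mul _)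
    (Filter.Eventually.of_forall fun y => by positivity), integral_const_mul, h2]
  congr 1
  field_simp

/-- A positive supersolution `K h ≤ q h` with `q < 1` excludes eigenvalues `μ ≥ 1`: an
eigenfunction satisfies `|f| ≤ K |f|`, and integrating against `h` gives
`∫ |f| h ≤ q ∫ |f| h`. -/
theorem eq_zero_of_supersolution {a T : ℝ} (ha : 0 < a) (hT : 0 < T) {h : ℝ → ℝ} {q : ℝ}
    (hpos : ∀ x, 0 < h x) (hL2 : MemLp h 2 volume) (hm : Measurable h) (hq0 : 0 ≤ q) (hq : q < 1)
    (hK : ∀ x, ∫⁻ y : ℝ, ENNReal.ofReal (gapKernel a T x y * h y) ≤ ENNReal.ofReal (q * h x))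
    {μ : ℝ} (hμ : 1 ≤ μ) {f : L2Line} (hf : gapOperator ha hT f = (μ : ℂ) • f) : f = 0 := by
  set I := ∫⁻ x, ENNReal.ofReal (‖f x‖ * h x) with hI
  have hfm : Measurable fun x => ‖f x‖ := (Lp.stronglyMeasurable f).norm.measurable
  have hKm : Measurable fun p : ℝ × ℝ => gapKernel a T p.1 p.2 :=
    (continuous_gapKernel a hT).measurable
  have hIfin : I ≠ ⊤ := by
    have hint : Integrable (fun x => ‖f x‖ * h x) := (Lp.memLp f).norm.integrable_mul hL2
    rw [hI, ← ofReal_integral_eq_lintegral_ofReal hint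
      (Filter.Eventually.of_forall fun x => mul_nonneg (norm_nonneg _) (hpos x).le)]
    exact ENNReal.ofReal_ne_top
  have hpt : ∀ᵐ x : ℝ, ENNReal.ofReal (‖f x‖ * h x) ≤
      ∫⁻ y, ENNReal.ofReal (‖f y‖ * (gapKernel a T y x * h x)) := by
    filter_upwards [coeFn_gapOperator ha hT f, Lp.coeFn_smul (μ : ℂ) f] with x h1 h2
    rw [hf, h2, Pi.smul_apply] at h1
    have h3 : ‖f x‖ ≤ ∫ y, gapKernel a T y x * ‖f y‖ := by
      calc ‖f x‖ ≤ μ * ‖f x‖ := by nlinarith [norm_nonneg (f x)]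
        _ = ‖(μ : ℂ) • f x‖ := by
          rw [norm_smul, Complex.norm_real, Real.norm_of_nonneg (by linarith)]
        _ ≤ ∫ y, ‖(gapKernel a T x y : ℂ) * f y‖ := by
          rw [h1]; exact norm_integral_le_integral_norm _
        _ = _ := by
          refine integral_congr_ae (Filter.Eventually.of_forall fun y => ?_)
          simp only [norm_mul, Complex.norm_real, gapKernel_comm a T x y,
            Real.norm_of_nonneg (gapKernel_nonneg a T y x)]
    have hint : Integrable fun y => gapKernel a T y x * ‖f y‖ := by
      refine (integrable_gapKernel_mul ha hT f x).norm.congr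
        (Filter.Eventually.of_forall fun y => ?_)
      simp only [norm_mul, Complex.norm_real, gapKernel_comm a T x y,
        Real.norm_of_nonneg (gapKernel_nonneg a T y x)]
    calc ENNReal.ofReal (‖f x‖ * h x)
        ≤ ENNReal.ofReal ((∫ y, gapKernel a T y x * ‖f y‖) * h x) :=
          ENNReal.ofReal_le_ofReal (mul_le_mul_of_nonneg_right h3 (hpos x).le)
      _ = _ := by
          rw [← integral_mul_const, ofReal_integral_eq_lintegral_ofReal (hint.mul_const _)
            (Filter.Eventually.of_forall fun y => mul_nonneg
              (mul_nonneg (gapKernel_nonneg _ _ _ _) (norm_nonneg _)) (hpos x).le)]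
          refine lintegral_congr fun y => ?_
          ring_nf
  have hle : I ≤ ENNReal.ofReal q * I := by
    calc I ≤ ∫⁻ x, ∫⁻ y, ENNReal.ofReal (‖f y‖ * (gapKernel a T y x * h x)) :=
          lintegral_mono_ae hpt
      _ = ∫⁻ y, ∫⁻ x, ENNReal.ofReal (‖f y‖ * (gapKernel a T y x * h x)) := by
          refine lintegral_lintegral_swap (Measurable.aemeasurable ?_)
          refine ENNReal.measurable_ofReal.comp ((hfm.comp measurable_snd).mul
            ((hKm.comp measurable_swap).mul (hm.comp measurable_fst)))
      _ ≤ ∫⁻ y, ENNReal.ofReal q * ENNReal.ofReal (‖f y‖ * h y) := by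
          refine lintegral_mono fun y => ?_
          simp only [ENNReal.ofReal_mul (norm_nonneg (f y))]
          rw [lintegral_const_mul' _ _ ENNReal.ofReal_ne_top]
          refine (mul_le_mul_right (hK y) _).trans (le_of_eq ?_)
          rw [ENNReal.ofReal_mul hq0, mul_left_comm]
      _ = ENNReal.ofReal q * I := lintegral_const_mul' _ _ ENNReal.ofReal_ne_top
  have hI0 : I = 0 := by
    by_contra hne
    have h1 : ENNReal.ofReal q * I < 1 * I :=
      (ENNReal.mul_lt_mul_iff_left hne hIfin).mpr (by simpa using hq)
    rw [one_mul] at h1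
    exact absurd hle (not_le.mpr h1)
  have hgm : Measurable fun x => ENNReal.ofReal (‖f x‖ * h x) :=
    ENNReal.measurable_ofReal.comp (hfm.mul hm)
  rw [hI, lintegral_eq_zero_iff hgm] at hI0
  refine (Lp.eq_zero_iff_ae_eq_zero).mpr ?_
  filter_upwards [hI0] with x hx
  simp only [Pi.zero_apply, ENNReal.ofReal_eq_zero] at hx
  have := nonpos_of_mul_nonpos_left hx (hpos x)
  simpa using norm_le_zero_iff.mp this

/-- A lower bound `S²` for the part of the denominator other than `(x - y)²` bounds `K h` at `x` by
a Poisson integral, for `h(y) = 1 / (y² + L²)`. -/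
theorem lintegral_gapKernel_mul_le {a T S L : ℝ} (hS : 0 < S) (hSL : S < L) {x : ℝ}
    (h : ∀ y, S ^ 2 ≤ T ^ 2 + a ^ 2 * (x ^ 2 + y ^ 2) ^ 2) :
    ∫⁻ y : ℝ, ENNReal.ofReal (gapKernel a T x y * (1 / (y ^ 2 + L ^ 2))) ≤
      ENNReal.ofReal ((L + S) / (S * L * (x ^ 2 + (L + S) ^ 2))) := by
  rw [← lintegral_poisson hS hSL x]
  refine lintegral_mono fun y => ENNReal.ofReal_le_ofReal ?_
  unfold gapKernel
  have h1 := h y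
  have hd : S ^ 2 + (x - y) ^ 2 ≤ T ^ 2 + (x - y) ^ 2 + a ^ 2 * (x ^ 2 + y ^ 2) ^ 2 := by linarith
  gcongr

/-- The Poisson kernel of width `L` comparable to `a^(-2/5)` is a supersolution as long as
`T ≥ 1 - 1/(25 L)`. For `|x| ≤ L/2` it is the spreading of the bump under the Poisson semigroup
that gains, for `|x| > L/2` it is the term `a² (x² + y²)²`. -/
theorem lintegral_gapKernel_mul_bump_le {a T L : ℝ} (hL : 40 ≤ L) (haL : a ^ 2 * L ^ 5 = 1024)
    (hT : 1 - 1 / (25 * L) ≤ T) (x : ℝ) :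
    ∫⁻ y : ℝ, ENNReal.ofReal (gapKernel a T x y * (1 / (y ^ 2 + L ^ 2))) ≤
      ENNReal.ofReal ((1 - 1 / (25 * L)) * (1 / (x ^ 2 + L ^ 2))) := by
  have hL0 : 0 < L := by linarith
  obtain ⟨d, hd⟩ : ∃ d, d = 1 / (25 * L) := ⟨_, rfl⟩
  have hdL : d * L = 1 / 25 := by rw [hd]; field_simp
  have hd0 : 0 < d := by rw [hd]; positivity
  have hd1 : d ≤ 1 / 1000 := by
    rw [hd]; exact one_div_le_one_div_of_le (by norm_num) (by linarith)
  rw [← hd] at hT ⊢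
  rcases le_or_gt (x ^ 2) (L ^ 2 / 4) with hx | hx
  -- Near the origin the quartic term is dropped; `1 - d` is at once the bound for `T` and the
  -- factor `q` to be gained.
  · refine (lintegral_gapKernel_mul_le (S := 1 - d) (by linarith) (by linarith) fun y => ?_).trans
      (ENNReal.ofReal_le_ofReal ?_)
    · have : (1 - d) ^ 2 ≤ T ^ 2 := by
        have : 0 ≤ 1 - d := by linarith
        gcongr
      have : 0 ≤ a ^ 2 * (x ^ 2 + y ^ 2) ^ 2 := by positivity
      linarith
    · have hS : 0 < 1 - d := by linarith
      have hLS : 0 < L + (1 - d) := by linarith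
      rw [mul_one_div, div_le_div_iff₀ (by positivity) (by positivity)]
      obtain ⟨X, hX⟩ : ∃ X, X = x ^ 2 := ⟨_, rfl⟩
      rw [← hX] at hx ⊢
      have e : (1 - d) * ((1 - d) * L * (X + (L + (1 - d)) ^ 2)) =
          (L - 2 / 25 + d / 25) * (X + (L + (1 - d)) ^ 2) := by
        have : (1 - d) * ((1 - d) * L) = L - 2 * (d * L) + d * (d * L) := by ring
        rw [← mul_assoc, this, hdL]; ring
      rw [e]
      have h1 : (L + (1 - d)) ^ 2 = L ^ 2 + 2 * L - 2 / 25 + (1 - d) ^ 2 := by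
        have : (L + (1 - d)) ^ 2 = L ^ 2 + 2 * L - 2 * (d * L) + (1 - d) ^ 2 := by ring
        rw [this, hdL]; ring
      have h2 : L ^ 2 + 2 * L ≤ (L + (1 - d)) ^ 2 := by rw [h1]; nlinarith
      have h3 : X + (L ^ 2 + 2 * L) ≤ X + (L + (1 - d)) ^ 2 := by linarith
      have h4 : (L - 2 / 25) * (X + (L ^ 2 + 2 * L)) ≤
          (L - 2 / 25 + d / 25) * (X + (L + (1 - d)) ^ 2) := by
        have : 0 ≤ X := by rw [hX]; positivity
        gcongr
        · linarith
        · linarith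
      have h5 : (L + (1 - d)) * (X + L ^ 2) ≤ (L + 1) * (X + L ^ 2) := by
        have : 0 ≤ X := by rw [hX]; positivity
        gcongr
        linarith
      refine h5.trans (le_trans ?_ h4)
      nlinarith
  -- Away from it `h` may grow by a factor of about `1 + 1/L` under the semigroup, but the quartic
  -- term is at least `64 / L`, which allows `S = 1 + 20/L`.
  · obtain ⟨s, hs⟩ : ∃ s, s = 20 / L := ⟨_, rfl⟩
    have hsL : s * L = 20 := by rw [hs]; field_simp
    have hs0 : 0 < s := by rw [hs]; positivity
    have hs1 : s ≤ 1 / 2 := by rw [hs, div_le_iff₀ hL0]; linarith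
    refine (lintegral_gapKernel_mul_le (S := 1 + s) (by linarith) (by linarith) fun y => ?_).trans
      (ENNReal.ofReal_le_ofReal ?_)
    · have h1 : (1 - d) ^ 2 ≤ T ^ 2 := by
        have : 0 ≤ 1 - d := by linarith
        gcongr
      have h2 : (L ^ 2 / 4) ^ 2 ≤ (x ^ 2 + y ^ 2) ^ 2 := by
        have : L ^ 2 / 4 ≤ x ^ 2 + y ^ 2 := by nlinarith [sq_nonneg y]
        gcongr
      have h3 : a ^ 2 * (L ^ 2 / 4) ^ 2 = 16 / 5 * s := by
        have : a ^ 2 * (L ^ 2 / 4) ^ 2 = a ^ 2 * L ^ 5 / (16 * L) := by field_simp; norm_num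
        rw [this, haL, hs]
        field_simp
        norm_num
      have h4 : a ^ 2 * (L ^ 2 / 4) ^ 2 ≤ a ^ 2 * (x ^ 2 + y ^ 2) ^ 2 := by gcongr
      have h5 : d = s / 500 := by rw [hd, hs]; field_simp; norm_num
      rw [h3] at h4
      nlinarith
    · have hLs : 0 < L + (1 + s) := by linarith
      have h1 : (L + (1 + s)) / ((1 + s) * L) ≤ 1 - d := by
        rw [div_le_iff₀ (by positivity)]
        have : (1 - d) * ((1 + s) * L) = L + s * L - d * L - s * (d * L) := by ring
        rw [this, hsL, hdL]
        linarith
      rw [← div_div]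
      calc (L + (1 + s)) / ((1 + s) * L) / (x ^ 2 + (L + (1 + s)) ^ 2)
          ≤ (1 - d) / (x ^ 2 + L ^ 2) := by
            have : 0 ≤ 1 - d := by linarith
            gcongr
            linarith
        _ = _ := by ring

theorem memLp_one_div_sq_add_sq {L : ℝ} (hL : 1 ≤ L) :
    MemLp (fun x : ℝ => 1 / (x ^ 2 + L ^ 2)) 2 (volume : Measure ℝ) := by
  refine memLp_inv_one_add_sq.mono' (Continuous.aestronglyMeasurable ?_)
    (Filter.Eventually.of_forall fun x => ?_)
  · exact continuous_const.div (by fun_prop) fun x => by positivity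
  · rw [Real.norm_of_nonneg (by positivity), ← one_div]
    apply one_div_le_one_div_of_le (by positivity)
    nlinarith

/-- Eigenvalues at least `1` occur only for `T < 1 - 1/(25 L)`, with `L = 4 a^(-2/5)`. -/
theorem lt_of_hasEigenvalue_one_le {a T L μ : ℝ} (ha : 0 < a) (hT : 0 < T) (hL : 40 ≤ L)
    (haL : a ^ 2 * L ^ 5 = 1024) (hμ : 1 ≤ μ)
    (h : Module.End.HasEigenvalue (oddGapOperator ha hT) (μ : ℂ)) : T < 1 - 1 / (25 * L) := by
  by_contra! hcon
  have hL0 : 0 < L := by linarith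
  obtain ⟨f, hf⟩ := h.exists_hasEigenvector
  have h1 : gapOperator ha hT f = (μ : ℂ) • (f : L2Line) := congrArg Subtype.val hf.apply_eq_smul
  have hd1 : 1 / (25 * L) ≤ 1 := by
    rw [div_le_one (by positivity)]; linarith
  refine hf.2 (Subtype.ext (eq_zero_of_supersolution ha hT (fun x => by positivity)
    (memLp_one_div_sq_add_sq (by linarith)) (by fun_prop) (sub_nonneg.mpr hd1) ?_
    (lintegral_gapKernel_mul_bump_le hL haL hcon) hμ h1))
  have : 0 < 1 / (25 * L) := by positivity
  linarith

/-! ### An odd trial function and the upper bound on `1 - T` -/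

/-- The odd bump `u ↦ u max(0, 1 - |u|)` rescaled to be supported on `[-L, L]`. -/
noncomputable def oddBump (L x : ℝ) : ℝ := x / L * max 0 (1 - |x / L|)

theorem continuous_oddBump (L : ℝ) : Continuous (oddBump L) := by
  unfold oddBump; fun_prop

theorem oddBump_neg (L x : ℝ) : oddBump L (-x) = -oddBump L x := by
  unfold oddBump; rw [neg_div, abs_neg, neg_mul]

theorem oddBump_eq_zero {L x : ℝ} (hL : 0 < L) (hx : x ∉ Set.Icc (-L) L) : oddBump L x = 0 := by
  have h : 1 ≤ |x / L| := by
    rw [abs_div, abs_of_pos hL, le_div_iff₀ hL, one_mul]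
    by_contra! h
    exact hx (abs_le.mp h.le)
  unfold oddBump
  rw [max_eq_left (by linarith), mul_zero]

theorem hasCompactSupport_oddBump {L : ℝ} (hL : 0 < L) : HasCompactSupport (oddBump L) :=
  HasCompactSupport.intro isCompact_Icc fun _ hx => oddBump_eq_zero hL hx

/-- The profile of the bump is `1`-Lipschitz with oscillation at most `1`. -/
theorem abs_mul_max_sub_le (u v : ℝ) :
    |u * max 0 (1 - |u|) - v * max 0 (1 - |v|)| ≤ min |u - v| 1 := by
  rw [le_min_iff]
  constructor
  · rw [← sq_le_sq]
    rcases le_total |u| 1 with hu | hu <;> rcases le_total |v| 1 with hv | hv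
    · rw [max_eq_right (by linarith), max_eq_right (by linarith), sq_le_sq]
      have h1 := abs_le.mp hu
      have h2 := abs_le.mp hv
      rcases abs_cases u with ⟨h3, h3'⟩ | ⟨h3, h3'⟩ <;>
        rcases abs_cases v with ⟨h4, h4'⟩ | ⟨h4, h4'⟩ <;>
        rw [h3, h4]
      · rw [show u * (1 - u) - v * (1 - v) = (u - v) * (1 - u - v) by ring, abs_mul]
        exact mul_le_of_le_one_right (abs_nonneg _) (abs_le.mpr ⟨by linarith, by linarith⟩)
      · rw [abs_of_nonneg (by linarith : 0 ≤ u - v), abs_le]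
        constructor <;> nlinarith
      · rw [abs_of_nonpos (by linarith : u - v ≤ 0), abs_le]
        constructor <;> nlinarith
      · rw [show u * (1 - -u) - v * (1 - -v) = (u - v) * (1 + u + v) by ring, abs_mul]
        exact mul_le_of_le_one_right (abs_nonneg _) (abs_le.mpr ⟨by linarith, by linarith⟩)
    · rw [max_eq_right (by linarith), max_eq_left (by linarith), mul_zero, sub_zero, sq_le_sq,
        abs_mul, abs_of_nonneg (by linarith : 0 ≤ 1 - |u|), abs_sub_comm]
      nlinarith [abs_sub_abs_le_abs_sub v u, abs_nonneg u]
    · rw [max_eq_left (by linarith), max_eq_right (by linarith), mul_zero, zero_sub, sq_le_sq,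
        abs_neg, abs_mul, abs_of_nonneg (by linarith : 0 ≤ 1 - |v|)]
      nlinarith [abs_sub_abs_le_abs_sub u v, abs_nonneg v]
    · rw [max_eq_left (by linarith), max_eq_left (by linarith)]
      nlinarith [sq_nonneg (u - v)]
  · have h : ∀ w : ℝ, |w * max 0 (1 - |w|)| ≤ 1 / 2 := fun w => by
      rw [abs_mul, abs_of_nonneg (le_max_left 0 (1 - |w|))]
      rcases le_total |w| 1 with hw | hw
      · rw [max_eq_right (by linarith)]; nlinarith [sq_nonneg (|w| - 1 / 2)]
      · rw [max_eq_left (by linarith)]; norm_num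
    refine (abs_sub _ _).trans ?_
    linarith [h u, h v]

/-- The increments of the bump, relative to the Poisson kernel `1 / (S² + (x - y)²)`, are
bounded by an integrable function. -/
theorem sq_oddBump_sub_mul_le {L : ℝ} (hL : 0 < L) (S x y : ℝ) :
    (oddBump L x - oddBump L y) ^ 2 * (1 / (S ^ 2 + (x - y) ^ 2)) ≤
      (Set.Icc (-L) L).indicator 1 x * (2 / (L ^ 2 + (x - y) ^ 2)) +
      (Set.Icc (-L) L).indicator 1 y * (2 / (L ^ 2 + (x - y) ^ 2)) := by
  have hχ : ∀ z, 0 ≤ (Set.Icc (-L) L).indicator (1 : ℝ → ℝ) z := fun z =>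
    Set.indicator_nonneg (fun _ _ => zero_le_one) z
  have hmain : (oddBump L x - oddBump L y) ^ 2 * (1 / (S ^ 2 + (x - y) ^ 2)) ≤
      2 / (L ^ 2 + (x - y) ^ 2) := by
    have h := abs_mul_max_sub_le (x / L) (y / L)
    change |oddBump L x - oddBump L y| ≤ _ at h
    obtain ⟨h1, h2⟩ := le_min_iff.mp h
    have h3 : (oddBump L x - oddBump L y) ^ 2 ≤ 1 := by
      rw [← sq_abs]; exact pow_le_one₀ (abs_nonneg _) h2
    have h4 : (oddBump L x - oddBump L y) ^ 2 * L ^ 2 ≤ (x - y) ^ 2 := by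
      rw [← sub_div] at h1
      have := sq_le_sq.mpr h1
      rwa [div_pow, le_div_iff₀ (by positivity)] at this
    rcases eq_or_lt_of_le (show 0 ≤ S ^ 2 + (x - y) ^ 2 by positivity) with h0 | h0
    · rw [← h0, div_zero, mul_zero]; positivity
    · rw [mul_one_div, div_le_div_iff₀ h0 (by positivity)]
      nlinarith [sq_nonneg S, sq_nonneg (x - y)]
  have hpos : 0 ≤ 2 / (L ^ 2 + (x - y) ^ 2) := by positivity
  by_cases hx : x ∈ Set.Icc (-L) L
  · rw [Set.indicator_of_mem hx, Pi.one_apply, one_mul]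
    exact hmain.trans (le_add_of_nonneg_right (mul_nonneg (hχ y) hpos))
  · by_cases hy : y ∈ Set.Icc (-L) L
    · rw [Set.indicator_of_mem hy, Pi.one_apply, one_mul]
      exact hmain.trans (le_add_of_nonneg_left (mul_nonneg (hχ x) hpos))
    · rw [oddBump_eq_zero hL hx, oddBump_eq_zero hL hy, sub_zero, zero_pow two_ne_zero, zero_mul]
      exact add_nonneg (mul_nonneg (hχ x) hpos) (mul_nonneg (hχ y) hpos)

theorem div_le_integral_sq_oddBump {L : ℝ} (hL : 0 < L) : L / 256 ≤ ∫ x, oddBump L x ^ 2 := by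
  have hint : Integrable (fun x => oddBump L x ^ 2) :=
    ((continuous_oddBump L).pow 2).integrable_of_hasCompactSupport
      (by simpa [pow_two] using (hasCompactSupport_oddBump hL).mul_left (f := oddBump L))
  have h1 : ∫ x in Set.Icc (L / 4) (L / 2), (1 / 64 : ℝ) = L / 256 := by
    rw [setIntegral_const, Measure.real, Real.volume_Icc, ENNReal.toReal_ofReal (by linarith),
      smul_eq_mul]
    ring
  rw [← h1]
  refine (setIntegral_mono_on (by simp) hint.integrableOn measurableSet_Icc fun x hx => ?_).trans
    (setIntegral_le_integral hint (Filter.Eventually.of_forall fun x => sq_nonneg _))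
  have hu1 : 1 / 4 ≤ x / L := by rw [le_div_iff₀ hL]; linarith [hx.1]
  have hu2 : x / L ≤ 1 / 2 := by rw [div_le_iff₀ hL]; linarith [hx.2]
  have h8 : 1 / 8 ≤ oddBump L x := by
    unfold oddBump
    rw [abs_of_nonneg (by linarith), max_eq_right (by linarith)]
    nlinarith
  nlinarith

theorem integrable_and_integral_inv_sq_add {S : ℝ} (hS : 0 < S) :
    Integrable (fun u : ℝ => 1 / (S ^ 2 + u ^ 2)) ∧
      ∫ u : ℝ, 1 / (S ^ 2 + u ^ 2) = Real.pi / S := by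
  have e : (fun u : ℝ => 1 / (S ^ 2 + u ^ 2)) = fun u => 1 / S ^ 2 * (1 + (u / S) ^ 2)⁻¹ := by
    ext u; field_simp
  rw [e]
  refine ⟨(integrable_inv_one_add_sq.comp_div hS.ne').const_mul _, ?_⟩
  rw [integral_const_mul, Measure.integral_comp_div (fun u : ℝ => (1 + u ^ 2)⁻¹),
    integral_univ_inv_one_add_sq, abs_of_pos hS, smul_eq_mul]
  field_simp

theorem integrable_and_integral_mul_sub {φ Q : ℝ → ℝ} (hφ : Integrable φ) (hQ : Integrable Q) :
    Integrable (fun p : ℝ × ℝ => φ p.1 * Q (p.1 - p.2)) ∧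
      ∫ p : ℝ × ℝ, φ p.1 * Q (p.1 - p.2) = (∫ x, φ x) * ∫ u, Q u := by
  have hmp : MeasurePreserving (fun p : ℝ × ℝ => (p.1, p.1 - p.2)) volume volume :=
    (MeasurePreserving.id volume).skew_product (g := fun x y => x - y) (by fun_prop)
      (Filter.Eventually.of_forall fun x => (Measure.measurePreserving_sub_left volume x).map_eq)
  have h1 : Integrable (fun p : ℝ × ℝ => φ p.1 * Q p.2) volume := hφ.mul_prod hQ
  have hI : Integrable (fun p : ℝ × ℝ => φ p.1 * Q (p.1 - p.2)) :=
    hmp.integrable_comp_of_integrable h1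
  refine ⟨hI, ?_⟩
  rw [Measure.volume_eq_prod, integral_prod _ hI, ← integral_mul_const]
  refine integral_congr_ae (Filter.Eventually.of_forall fun x => ?_)
  simp only
  rw [integral_const_mul, integral_sub_left_eq_self (fun u => Q u) volume x]

theorem integrable_and_integral_mul_sub' {φ Q : ℝ → ℝ} (hφ : Integrable φ) (hQ : Integrable Q)
    (hQe : ∀ u, Q (-u) = Q u) :
    Integrable (fun p : ℝ × ℝ => φ p.2 * Q (p.1 - p.2)) ∧
      ∫ p : ℝ × ℝ, φ p.2 * Q (p.1 - p.2) = (∫ x, φ x) * ∫ u, Q u := by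
  obtain ⟨h1, h2⟩ := integrable_and_integral_mul_sub hφ hQ
  have e : (fun p : ℝ × ℝ => φ p.2 * Q (p.1 - p.2)) =
      (fun p : ℝ × ℝ => φ p.1 * Q (p.1 - p.2)) ∘ Prod.swap := by
    ext p; simp [← hQe (p.1 - p.2)]
  have hmp : MeasurePreserving (Prod.swap : ℝ × ℝ → ℝ × ℝ) volume volume :=
    Measure.measurePreserving_swap
  rw [e]
  refine ⟨hmp.integrable_comp_of_integrable h1, ?_⟩
  rw [← h2]
  exact hmp.integral_comp MeasurableEquiv.prodComm.measurableEmbedding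
    (fun p : ℝ × ℝ => φ p.1 * Q (p.1 - p.2))

theorem integrable_oddBump_mul {L : ℝ} (hL : 0 < L) {k : ℝ × ℝ → ℝ} (hk : Continuous k) :
    Integrable (fun p : ℝ × ℝ => oddBump L p.1 * oddBump L p.2 * k p) := by
  refine Continuous.integrable_of_hasCompactSupport ?_ ?_
  · exact (((continuous_oddBump L).comp continuous_fst).mul
      ((continuous_oddBump L).comp continuous_snd)).mul hk
  · refine HasCompactSupport.intro (isCompact_Icc.prod isCompact_Icc :
      IsCompact (Set.Icc (-L) L ×ˢ Set.Icc (-L) L)) fun p hp => ?_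
    rw [Set.mem_prod, not_and_or] at hp
    rcases hp with hp | hp <;> simp [oddBump_eq_zero hL hp]

/-- The polarization `2 F(x) F(y) = F(x)² + F(y)² - (F(x) - F(y))²`, integrated against
`1 / (S² + (x - y)²)`, which has mass `π / S` in either variable. -/
theorem integral_oddBump_mul_poisson_ge {L S : ℝ} (hL : 0 < L) (hS : 0 < S) :
    Real.pi / S * (∫ x, oddBump L x ^ 2) - 4 * Real.pi ≤
      ∫ p : ℝ × ℝ, oddBump L p.1 * oddBump L p.2 * (1 / (S ^ 2 + (p.1 - p.2) ^ 2)) := by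
  have hint : Integrable (fun x => oddBump L x ^ 2) :=
    ((continuous_oddBump L).pow 2).integrable_of_hasCompactSupport
      (by simpa [pow_two] using (hasCompactSupport_oddBump hL).mul_left (f := oddBump L))
  obtain ⟨hP, hPi⟩ := integrable_and_integral_inv_sq_add hS
  obtain ⟨hQ, hQi⟩ := integrable_and_integral_inv_sq_add hL
  obtain ⟨hA, hAi⟩ := integrable_and_integral_mul_sub hint hP
  obtain ⟨hB, hBi⟩ := integrable_and_integral_mul_sub' hint hP (by simp)
  have hχ : Integrable ((Set.Icc (-L) L).indicator (1 : ℝ → ℝ)) :=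
    (integrable_indicator_iff measurableSet_Icc).mpr
      (integrableOn_const (C := (1 : ℝ)) (by simp))
  have hχi : ∫ x, (Set.Icc (-L) L).indicator (1 : ℝ → ℝ) x = 2 * L := by
    rw [integral_indicator_one measurableSet_Icc, Measure.real, Real.volume_Icc,
      ENNReal.toReal_ofReal (by linarith)]
    ring
  obtain ⟨hC, hCi⟩ := integrable_and_integral_mul_sub hχ (hQ.const_mul 2)
  obtain ⟨hD, hDi⟩ := integrable_and_integral_mul_sub' hχ (hQ.const_mul 2) (by simp)
  rw [hPi] at hAi hBi
  rw [integral_const_mul, hQi, hχi] at hCi hDi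
  have hF : Integrable (fun p : ℝ × ℝ =>
      oddBump L p.1 * oddBump L p.2 * (1 / (S ^ 2 + (p.1 - p.2) ^ 2))) :=
    integrable_oddBump_mul hL (k := fun p => 1 / (S ^ 2 + (p.1 - p.2) ^ 2))
      (continuous_const.div (by fun_prop) fun p => by positivity)
  have hAB : Integrable (fun p : ℝ × ℝ => oddBump L p.1 ^ 2 * (1 / (S ^ 2 + (p.1 - p.2) ^ 2)) +
      oddBump L p.2 ^ 2 * (1 / (S ^ 2 + (p.1 - p.2) ^ 2))) := hA.add hB
  have hmono : ∫ p : ℝ × ℝ, (oddBump L p.1 ^ 2 * (1 / (S ^ 2 + (p.1 - p.2) ^ 2)) +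
        oddBump L p.2 ^ 2 * (1 / (S ^ 2 + (p.1 - p.2) ^ 2)) -
        2 * (oddBump L p.1 * oddBump L p.2 * (1 / (S ^ 2 + (p.1 - p.2) ^ 2)))) ≤
      ∫ p : ℝ × ℝ, ((Set.Icc (-L) L).indicator 1 p.1 * (2 * (1 / (L ^ 2 + (p.1 - p.2) ^ 2))) +
        (Set.Icc (-L) L).indicator 1 p.2 * (2 * (1 / (L ^ 2 + (p.1 - p.2) ^ 2)))) := by
    refine integral_mono (hAB.sub (hF.const_mul 2)) (hC.add hD) fun p => ?_
    have := sq_oddBump_sub_mul_le hL S p.1 p.2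
    simp only [mul_one_div (2 : ℝ)]
    refine le_trans (le_of_eq ?_) this
    ring
  rw [integral_sub hAB (hF.const_mul 2), integral_add hA hB, integral_add hC hD,
    integral_const_mul, hAi, hBi, hCi, hDi] at hmono
  have e : 2 * L * (2 * (Real.pi / L)) = 4 * Real.pi := by field_simp; norm_num
  rw [e] at hmono
  linarith

/-- On odd functions only the odd part of a kernel acts. -/
theorem integral_oddBump_mul_symm {L : ℝ} (hL : 0 < L) {k : ℝ → ℝ → ℝ}
    (hk : Continuous fun p : ℝ × ℝ => k p.1 p.2) :
    2 * ∫ p : ℝ × ℝ, oddBump L p.1 * oddBump L p.2 * k p.1 p.2 =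
      ∫ p : ℝ × ℝ, oddBump L p.1 * oddBump L p.2 * (k p.1 p.2 - k p.1 (-p.2)) := by
  have h1 := integrable_oddBump_mul hL hk
  have h2 := integrable_oddBump_mul hL (k := fun p => k p.1 (-p.2))
    (hk.comp (continuous_fst.prodMk continuous_snd.neg))
  simp only [mul_sub]
  rw [integral_sub h1 h2, two_mul, sub_eq_add_neg]
  congr 1
  rw [Measure.volume_eq_prod, integral_prod _ h1, integral_prod _ h2, ← integral_neg]
  refine integral_congr_ae (Filter.Eventually.of_forall fun x => ?_)
  simp only
  rw [← integral_neg_eq_self, ← integral_neg]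
  refine integral_congr_ae (Filter.Eventually.of_forall fun y => ?_)
  simp only [oddBump_neg]
  ring

/-- The odd part in `y` of `1 / (s + (x - y)²)` is a multiple of
`x y / ((s + (x - y)²) (s + (x + y)²))`, which decreases in `s` where `x y > 0`. On `[-L, L]` the
kernel has `s = T² + a² (x² + y²)² ≤ T² + 4 a² L⁴`. -/
theorem oddBump_mul_poisson_le {a T L S : ℝ} (hL : 0 < L) (hT : 0 < T) (hS : 0 < S)
    (hTS : T ^ 2 + 4 * a ^ 2 * L ^ 4 ≤ S ^ 2) (x y : ℝ) :
    oddBump L x * oddBump L y *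
        (1 / (S ^ 2 + (x - y) ^ 2) - 1 / (S ^ 2 + (x - -y) ^ 2)) ≤
      oddBump L x * oddBump L y *
        (Real.pi * gapKernel a T x y - Real.pi * gapKernel a T x (-y)) := by
  by_cases hx : x ∈ Set.Icc (-L) L
  swap
  · simp [oddBump_eq_zero hL hx]
  by_cases hy : y ∈ Set.Icc (-L) L
  swap
  · simp [oddBump_eq_zero hL hy]
  have hx2 : x ^ 2 ≤ L ^ 2 := sq_le_sq' hx.1 hx.2
  have hy2 : y ^ 2 ≤ L ^ 2 := sq_le_sq' hy.1 hy.2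
  set V := a ^ 2 * (x ^ 2 + y ^ 2) ^ 2 with hV
  have hV0 : 0 ≤ V := by positivity
  have hVL : T ^ 2 + V ≤ S ^ 2 := by
    have : V ≤ a ^ 2 * (L ^ 2 + L ^ 2) ^ 2 := by rw [hV]; gcongr
    nlinarith
  have k1 : Real.pi * gapKernel a T x y = 1 / (T ^ 2 + (x - y) ^ 2 + V) := by
    unfold gapKernel; rw [hV]; field_simp
  have k2 : Real.pi * gapKernel a T x (-y) = 1 / (T ^ 2 + (x - -y) ^ 2 + V) := by
    unfold gapKernel; rw [hV, neg_sq]; field_simp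
  have d1 : 0 < T ^ 2 + (x - y) ^ 2 + V := by positivity
  have d2 : 0 < T ^ 2 + (x - -y) ^ 2 + V := by positivity
  have d3 : 0 < S ^ 2 + (x - y) ^ 2 := by positivity
  have d4 : 0 < S ^ 2 + (x - -y) ^ 2 := by positivity
  rw [k1, k2, div_sub_div _ _ d3.ne' d4.ne', div_sub_div _ _ d1.ne' d2.ne']
  have n1 : 1 * (S ^ 2 + (x - -y) ^ 2) - (S ^ 2 + (x - y) ^ 2) * 1 = 4 * (x * y) := by ring
  have n2 : 1 * (T ^ 2 + (x - -y) ^ 2 + V) - (T ^ 2 + (x - y) ^ 2 + V) * 1 = 4 * (x * y) := by ring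
  rw [n1, n2, ← mul_div_assoc, ← mul_div_assoc]
  have hnum : 0 ≤ oddBump L x * oddBump L y * (4 * (x * y)) := by
    have : oddBump L x * oddBump L y * (4 * (x * y)) =
        4 * (x ^ 2 / L * max 0 (1 - |x / L|)) * (y ^ 2 / L * max 0 (1 - |y / L|)) := by
      unfold oddBump; ring
    rw [this]
    have := le_max_left 0 (1 - |x / L|)
    have := le_max_left 0 (1 - |y / L|)
    positivity
  refine div_le_div_of_nonneg_left hnum (mul_pos d1 d2) ?_
  gcongr ?_ * ?_ <;> linarith

theorem integral_oddBump_mul_poisson_le {a T L S : ℝ} (hL : 0 < L) (hT : 0 < T) (hS : 0 < S)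
    (hTS : T ^ 2 + 4 * a ^ 2 * L ^ 4 ≤ S ^ 2) :
    ∫ p : ℝ × ℝ, oddBump L p.1 * oddBump L p.2 * (1 / (S ^ 2 + (p.1 - p.2) ^ 2)) ≤
      Real.pi * ∫ p : ℝ × ℝ, oddBump L p.1 * oddBump L p.2 * gapKernel a T p.1 p.2 := by
  have hc1 : Continuous fun p : ℝ × ℝ => 1 / (S ^ 2 + (p.1 - p.2) ^ 2) :=
    continuous_const.div (by fun_prop) fun p => by positivity
  have hc2 : Continuous fun p : ℝ × ℝ => Real.pi * gapKernel a T p.1 p.2 :=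
    continuous_const.mul (continuous_gapKernel a hT)
  have h2 := integral_oddBump_mul_symm hL (k := fun x y => Real.pi * gapKernel a T x y) hc2
  have h1 := integral_oddBump_mul_symm hL (k := fun x y => 1 / (S ^ 2 + (x - y) ^ 2)) hc1
  have e : Real.pi * ∫ p : ℝ × ℝ, oddBump L p.1 * oddBump L p.2 * gapKernel a T p.1 p.2 =
      ∫ p : ℝ × ℝ, oddBump L p.1 * oddBump L p.2 * (Real.pi * gapKernel a T p.1 p.2) := by
    rw [← integral_const_mul]
    refine integral_congr_ae (Filter.Eventually.of_forall fun p => ?_)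
    simp only
    ring
  rw [e]
  suffices h : ∫ p : ℝ × ℝ, oddBump L p.1 * oddBump L p.2 *
        (1 / (S ^ 2 + (p.1 - p.2) ^ 2) - 1 / (S ^ 2 + (p.1 - -p.2) ^ 2)) ≤
      ∫ p : ℝ × ℝ, oddBump L p.1 * oddBump L p.2 *
        (Real.pi * gapKernel a T p.1 p.2 - Real.pi * gapKernel a T p.1 (-p.2)) by
    linarith
  refine integral_mono (integrable_oddBump_mul hL (k := fun p => 1 / (S ^ 2 + (p.1 - p.2) ^ 2) -
      1 / (S ^ 2 + (p.1 - -p.2) ^ 2)) ?_) (integrable_oddBump_mul hL (k := fun p =>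
      Real.pi * gapKernel a T p.1 p.2 - Real.pi * gapKernel a T p.1 (-p.2)) ?_) fun p => ?_
  · exact hc1.sub (hc1.comp (continuous_fst.prodMk continuous_snd.neg))
  · exact hc2.sub (hc2.comp (continuous_fst.prodMk continuous_snd.neg))
  exact oddBump_mul_poisson_le hL hT hS hTS p.1 p.2

theorem memLp_oddBump {L : ℝ} (hL : 0 < L) :
    MemLp (fun x => (oddBump L x : ℂ)) 2 (volume : Measure ℝ) :=
  (Complex.continuous_ofReal.comp (continuous_oddBump L)).memLp_of_hasCompactSupport
    ((hasCompactSupport_oddBump hL).comp_left Complex.ofReal_zero)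

/-- The odd bump as an element of `Hᵒ`. -/
noncomputable def oddBumpLp {L : ℝ} (hL : 0 < L) : oddSubspace :=
  ⟨(memLp_oddBump hL).toLp _, by
    change ∀ᵐ x : ℝ, ((memLp_oddBump hL).toLp _ : ℝ → ℂ) (-x) =
      -((memLp_oddBump hL).toLp _ : ℝ → ℂ) x
    filter_upwards [(memLp_oddBump hL).coeFn_toLp, ae_comp_neg (memLp_oddBump hL).coeFn_toLp]
      with x h1 h2
    rw [h1, h2, oddBump_neg, Complex.ofReal_neg]⟩

theorem norm_oddBumpLp_sq {L : ℝ} (hL : 0 < L) : ‖oddBumpLp hL‖ ^ 2 = ∫ x, oddBump L x ^ 2 := by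
  change ‖(memLp_oddBump hL).toLp _‖ ^ 2 = _
  rw [← inner_self_eq_norm_sq (𝕜 := ℂ), L2.inner_def, ← integral_re (L2.integrable_inner _ _)]
  refine integral_congr_ae ?_
  filter_upwards [(memLp_oddBump hL).coeFn_toLp] with x h1
  rw [inner_self_eq_norm_sq, h1, Complex.norm_real, Real.norm_eq_abs, sq_abs]

theorem reApplyInnerSelf_oddBumpLp {a T L : ℝ} (ha : 0 < a) (hT : 0 < T) (hL : 0 < L) :
    (oddGapCLM ha hT).reApplyInnerSelf (oddBumpLp hL) =
      ∫ p : ℝ × ℝ, oddBump L p.1 * oddBump L p.2 * gapKernel a T p.1 p.2 := by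
  have h1 := integrable_oddBump_mul hL (continuous_gapKernel a hT)
  rw [Measure.volume_eq_prod, integral_prod _ h1]
  change RCLike.re (inner ℂ (gapOperator ha hT ((memLp_oddBump hL).toLp _))
    ((memLp_oddBump hL).toLp _)) = _
  rw [L2.inner_def, ← integral_re (L2.integrable_inner _ _)]
  refine integral_congr_ae ?_
  filter_upwards [(memLp_oddBump hL).coeFn_toLp,
    coeFn_gapOperator ha hT ((memLp_oddBump hL).toLp _)] with x h2 h3
  have h4 : ∫ y : ℝ, (gapKernel a T x y : ℂ) * ((memLp_oddBump hL).toLp _ : ℝ → ℂ) y =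
      ((∫ y : ℝ, gapKernel a T x y * oddBump L y : ℝ) : ℂ) := by
    rw [← integral_complex_ofReal]
    refine integral_congr_ae ?_
    filter_upwards [(memLp_oddBump hL).coeFn_toLp] with y hy
    rw [hy, Complex.ofReal_mul]
  rw [h3, h2, h4, RCLike.inner_apply, Complex.conj_ofReal, ← Complex.ofReal_mul]
  change oddBump L x * _ = _
  rw [← integral_const_mul]
  refine integral_congr_ae (Filter.Eventually.of_forall fun y => ?_)
  simp only
  ring

/-- If `T ≤ 1 - C a^(2/5)`, with `C = 2000000` and `L = a^(-2/5)`, the bump of width `L` has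
Rayleigh quotient above `1`. -/
theorem one_lt_oddGapSup {a T L : ℝ} (ha : 0 < a) (hT : 0 < T) (hL : 2000000 ≤ L)
    (haL : a ^ 2 * L ^ 5 = 1) (h : T ≤ 1 - 2000000 / L) : 1 < oddGapSup ha hT := by
  have hL0 : 0 < L := by linarith
  obtain ⟨e, he⟩ : ∃ e, e = 1 / L := ⟨_, rfl⟩
  have he0 : 0 < e := by rw [he]; positivity
  have heL : e * L = 1 := by rw [he]; field_simp
  have he1 : 2000000 * e ≤ 1 := by nlinarith
  have h' : T ≤ 1 - 2000000 * e := by rw [he]; convert h using 2; ring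
  have haL4 : 4 * a ^ 2 * L ^ 4 = 4 * e := by
    have : 4 * a ^ 2 * L ^ 4 * (e * L) = 4 * e * (a ^ 2 * L ^ 5) := by ring
    rwa [heL, haL, mul_one, mul_one] at this
  -- This `S` has `T² + 4 e ≤ S²`, and `1 / S - 1` exceeds `1024 e`; the loss `4` from the
  -- increments is at most `1024 e ‖F‖²`.
  obtain ⟨S, hS⟩ : ∃ S, S = 1 - 500000 * e := ⟨_, rfl⟩
  have hS0 : 0 < S := by rw [hS]; linarith
  have hTS : T ^ 2 + 4 * a ^ 2 * L ^ 4 ≤ S ^ 2 := by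
    rw [haL4, hS]; nlinarith
  have h1 := integral_oddBump_mul_poisson_ge hL0 hS0
  have h2 := integral_oddBump_mul_poisson_le hL0 hT hS0 hTS
  rw [← reApplyInnerSelf_oddBumpLp ha hT hL0] at h2
  rw [← norm_oddBumpLp_sq hL0] at h1
  have h3 := reApplyInnerSelf_le_rayleighSup (oddGapCLM ha hT) (oddBumpLp hL0)
  have h4 := div_le_integral_sq_oddBump hL0
  rw [← norm_oddBumpLp_sq hL0] at h4
  obtain ⟨N, hN⟩ : ∃ N, N = ‖oddBumpLp hL0‖ ^ 2 := ⟨_, rfl⟩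
  rw [← hN] at h1 h3 h4
  change _ ≤ oddGapSup ha hT * N at h3
  have hN0 : 0 < N := by linarith
  have h5 : 1 / S * N - 4 ≤ oddGapSup ha hT * N := by
    have : Real.pi * (1 / S * N - 4) ≤ Real.pi * (oddGapSup ha hT * N) := by
      refine le_trans (le_of_eq (by ring)) (h1.trans (h2.trans ?_))
      gcongr
    exact le_of_mul_le_mul_left this Real.pi_pos
  have h6 : 1 + 500000 * e ≤ 1 / S := by
    rw [le_div_iff₀ hS0, hS]; nlinarith [sq_nonneg e]
  have h7 : (1 + 500000 * e) * N ≤ 1 / S * N := by gcongr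
  have h8 : 1 ≤ 256 * e * N := by nlinarith
  nlinarith

/-- The intermediate value theorem between `T = 1 - 2000000 / L` and `T = 1`. -/
theorem exists_oddGapSup_eq_one {a L : ℝ} (ha : 0 < a) (hL : 2000000 < L)
    (haL : a ^ 2 * L ^ 5 = 1) : ∃ (T : ℝ) (hT : 0 < T), T ≤ 1 ∧ oddGapSup ha hT = 1 := by
  have hL0 : 0 < L := by linarith
  obtain ⟨T₀, hT₀⟩ : ∃ T₀, T₀ = 1 - 2000000 / L := ⟨_, rfl⟩
  have h0 : 0 < T₀ := by
    rw [hT₀, sub_pos, div_lt_one hL0]; exact hL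
  have h01 : T₀ ≤ 1 := by
    rw [hT₀]; have : 0 < 2000000 / L := by positivity
    linarith
  obtain ⟨C, hC0, hC⟩ := abs_oddGapSup_sub_le ha h0
  -- The parametrization `T = max T₀ t` makes the positivity of `T` available for every real `t`.
  have hpos : ∀ t, 0 < max T₀ t := fun t => lt_max_of_lt_left h0
  have hcont : Continuous fun t => oddGapSup ha (hpos t) := by
    refine continuous_iff_continuousAt.mpr fun t => ?_
    rw [ContinuousAt, tendsto_iff_dist_tendsto_zero]
    have hg : Continuous fun s : ℝ => C * |max T₀ s ^ 2 - max T₀ t ^ 2| := by fun_prop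
    have hg0 := hg.tendsto t
    simp only [sub_self, abs_zero, mul_zero] at hg0
    exact squeeze_zero (fun _ => dist_nonneg)
      (fun s => hC (hpos s) (hpos t) (le_max_left _ _) (le_max_left _ _)) hg0
  have hleft : 1 ≤ oddGapSup ha (hpos T₀) :=
    (one_lt_oddGapSup ha (hpos T₀) hL.le haL (by rw [max_self, hT₀])).le
  have hright : oddGapSup ha (hpos 1) ≤ 1 := by
    by_contra! hlt
    have hev := (isOddTopEigenvalue_oddGapSup ha (hpos 1) (by linarith)).1
    have := lt_of_hasEigenvalue_one_le (L := 4 * L) ha (hpos 1) (by linarith)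
      (by linear_combination 1024 * haL) hlt.le hev
    rw [max_eq_right h01] at this
    have : 0 < 1 / (25 * (4 * L)) := by positivity
    linarith
  obtain ⟨t, ht, heq⟩ := intermediate_value_Icc' h01 hcont.continuousOn ⟨hright, hleft⟩
  exact ⟨max T₀ t, hpos t, max_le h01 ht.2, heq⟩

theorem proposition10 :
    ∃ c C a₀ : ℝ, 0 < c ∧ 0 < C ∧ 0 < a₀ ∧
      ∀ (a : ℝ) (ha : 0 < a), a < a₀ →
        (∃ (T : ℝ) (hT : 0 < T), T < 1 ∧ IsOddTopEigenvalue ha hT 1) ∧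
        ∀ (T : ℝ) (hT : 0 < T), IsOddTopEigenvalue ha hT 1 →
          c * a ^ ((2 : ℝ) / 5) ≤ 1 - T ∧ 1 - T ≤ C * a ^ ((2 : ℝ) / 5) := by
  refine ⟨1 / 100, 2000000, (1 / 2000000) ^ ((5 : ℝ) / 2), by norm_num, by norm_num, by positivity,
    fun a ha haa => ?_⟩
  obtain ⟨e, he⟩ : ∃ e, e = a ^ ((2 : ℝ) / 5) := ⟨_, rfl⟩
  have he0 : 0 < e := by rw [he]; positivity
  have he1 : e < 1 / 2000000 := by
    have := Real.rpow_lt_rpow ha.le haa (by norm_num : (0 : ℝ) < 2 / 5)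
    rw [← Real.rpow_mul (by norm_num)] at this
    norm_num at this
    rw [he]
    norm_num
    exact this
  have he5 : e ^ 5 = a ^ 2 := by
    rw [he, ← Real.rpow_natCast, ← Real.rpow_mul ha.le]
    norm_num
  have haL : a ^ 2 * (1 / e) ^ 5 = 1 := by rw [← he5]; field_simp
  have hL : 2000000 < 1 / e := by rw [lt_div_iff₀ he0]; linarith
  have hlower : ∀ (T : ℝ) (hT : 0 < T), IsOddTopEigenvalue ha hT 1 → T < 1 - e / 100 := by
    intro T hT h
    have h1 := lt_of_hasEigenvalue_one_le (L := 4 * (1 / e)) ha hT (by linarith)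
      (by linear_combination 1024 * haL) le_rfl h.1
    convert h1 using 2
    field_simp
    norm_num
  rw [← he]
  refine ⟨?_, fun T hT h => ⟨by linarith [hlower T hT h], ?_⟩⟩
  · obtain ⟨T, hT, -, h1⟩ := exists_oddGapSup_eq_one ha hL haL
    have h := isOddTopEigenvalue_oddGapSup ha hT (by rw [h1]; exact one_pos)
    rw [h1] at h
    exact ⟨T, hT, by linarith [hlower T hT h], h⟩
  · by_contra! hcon
    have h1 := one_lt_oddGapSup ha hT hL.le haL (by field_simp; linarith)
    have h2 := (isOddTopEigenvalue_oddGapSup ha hT (by linarith)).1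
    exact absurd (h.2 h2) (not_le.mpr h1)
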